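/- Conventions. Let $\omega$ be a free ultrafilter on $\mathbb N$. For a unital C*-algebra $A$ let $A_\omega=\ell^\infty(\mathbb N,A)/\{(a_n)_n:\lim_\omega\|a_n\|=0\}$ be its ultrapower, regard $A$ as the subalgebra of $A_\omega$ of classes of constant sequences, and write $A_\omega\cap A'$ for its relative commutant. An action $\alpha:G\to\operatorname{Aut}(A)$ of a group $G$ induces an action $\alpha_\omega$ on $A_\omega$ by applying $\alpha_g$ termwise. For positive elements $a,b$ of a C*-algebra $B$, $a\lesssim b$ (Cuntz subequivalence) means that there is a sequence $(x_n)$ in $B$ with $\|x_nbx_n^*-a\|\to 0$; in particular $1-g\lesssim b$ includes $1-g\ge 0$. A completely positive map $\psi$ has order zero if $\psi(a)\psi(b)=\psi(b)\psi(a)=0$ for all positive $a,b$ with $ab=ba=0$. Let $\alpha$ be an action of a finite group $G$ on a unital C*-algebra $A$. It has the generalized tracial Rokhlin property if for every finite set $F\subset A$, every $\epsilon>0$ and every nonzero positive $x\in A$ there are positive elements $(e_g)_{g\in G}$ of $A$ with $\|e_g\|=1$ such that 1. $e_ge_h=0$ for $g\ne h$; 2. $\|\alpha_g(e_h)-e_{gh}\|\le\epsilon$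 for all $g,h\in G$; 3. $\|e_ga-ae_g\|\le\epsilon$ for all $g\in G$, $a\in F$; 4. $1_A-\sum_{g\in G}e_g\lesssim x$. Let $\beta$ be an action of $G$ on a unital C*-algebra $B$. A $G$-equivariant $*$-homomorphism $\phi:(A,\alpha)\to(B,\beta)$ is $G$-tracially sequentially-split by order zero if for every nonzero positive $x\in A_\omega$ there are a $G$-equivariant completely positive order zero map $\psi:(B,\beta)\to(A_\omega,\alpha_\omega)$ and a nonzero positive element $g\in A_\omega\cap A'$ such that $\psi(\phi(a))=ga=ag$ for all $a\in A$, and $1_{A_\omega}-g\lesssim x$. Statement. Let $G$ be a finite group and $\alpha:G\to\operatorname{Aut}(A)$ an action of $G$ on a simple separable unital infinite-dimensional C*-algebra $A$. Let $\sigma$ be the action of $G$ on $C(G)$ given by $\sigma_g(f)=f(g^{-1}\,\cdot)$. Then $\alpha$ has the generalized tracial Rokhlin property if and only if the map $$1_{C(G)}\otimes\operatorname{id}_A:(A,\alpha)\to(C(G)\otimes A,\sigma\otimes\alpha),\qquad a\mapsto 1_{C(G)}\otimes a,$$ is $G$-tracially sequentially-split by order zero. -/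

import Mathlib

open Filter Topology
open scoped BoundedContinuousFunction CStarAlgebra TensorProduct

noncomputable section

/-! ## Simplicity and Cuntz subequivalence -/

/-- A C⋆-algebra is simple if it is nonzero and has no closed two-sided ideals other than
`0` and itself. -/
def IsSimpleCStarAlgebra (A : Type*) [CStarAlgebra A] : Prop :=
  Nontrivial A ∧ ∀ I : TwoSidedIdeal A, IsClosed {a : A | a ∈ I} → I = ⊥ ∨ I = ⊤

/-- Cuntz subequivalence `a ≲ b`: there is a sequence `xₙ` with `‖xₙ b xₙ⋆ - a‖ → 0`. -/
def CuntzSubequiv {B : Type*} [CStarAlgebra B] (a b : B) : Prop :=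
  ∃ x : ℕ → B, Tendsto (fun n => ‖x n * b * star (x n) - a‖) atTop (𝓝 0)

/-- A completely positive map `φ` has order zero if it sends orthogonal positive elements to
orthogonal elements. -/
def CompletelyPositiveMap.IsOrderZero {B C : Type*} [CStarAlgebra B] [PartialOrder B]
    [StarOrderedRing B] [CStarAlgebra C] [PartialOrder C] [StarOrderedRing C]
    (φ : B →CP C) : Prop :=
  ∀ a b : B, 0 ≤ a → 0 ≤ b → a * b = 0 → b * a = 0 → φ a * φ b = 0 ∧ φ b * φ a = 0

/-! ## The ultrapower

`ℕ →ᵇ A` is the C⋆-algebra `ℓ^∞(ℕ, A)`, since every function on the discrete space `ℕ` is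
continuous. -/

section Ultrapower

variable {A : Type*} [CStarAlgebra A] (ω : Ultrafilter ℕ)

variable (A) in
/-- The closed ideal `c_ω(ℕ, A)` of bounded sequences with `lim_ω ‖a n‖ = 0`. -/
def cOmega : Ideal (ℕ →ᵇ A) where
  carrier := {a | Tendsto (fun n => ‖a n‖) ω (𝓝 0)}
  add_mem' {a b} ha hb := by
    have h : Tendsto (fun n => ‖a n‖ + ‖b n‖) ω (𝓝 0) := by
      have := Tendsto.add ha hb
      rwa [add_zero] at this
    exact squeeze_zero (fun n => norm_nonneg _) (fun n => norm_add_le (a n) (b n)) h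
  zero_mem' := by simp
  smul_mem' c a ha := by
    have h : Tendsto (fun n => ‖c‖ * ‖a n‖) ω (𝓝 0) := by
      have := Tendsto.const_mul ‖c‖ ha
      rwa [mul_zero] at this
    refine squeeze_zero (fun n => norm_nonneg _) (fun n => ?_) h
    calc ‖(c • a) n‖ = ‖c n * a n‖ := rfl
      _ ≤ ‖c n‖ * ‖a n‖ := norm_mul_le _ _
      _ ≤ ‖c‖ * ‖a n‖ := by gcongr; exact c.norm_coe_le_norm n

variable {ω}

theorem mem_cOmega {a : ℕ →ᵇ A} : a ∈ cOmega A ω ↔ Tendsto (fun n => ‖a n‖) ω (𝓝 0) := Iff.rfl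

instance cOmega_isTwoSided : (cOmega A ω).IsTwoSided where
  mul_mem_of_left {a} b ha := by
    rw [mem_cOmega] at ha ⊢
    have h : Tendsto (fun n => ‖a n‖ * ‖b‖) ω (𝓝 0) := by
      have := Tendsto.mul_const ‖b‖ ha
      rwa [zero_mul] at this
    refine squeeze_zero (fun n => norm_nonneg _) (fun n => ?_) h
    calc ‖(a * b) n‖ = ‖a n * b n‖ := rfl
      _ ≤ ‖a n‖ * ‖b n‖ := norm_mul_le _ _
      _ ≤ ‖a n‖ * ‖b‖ := by gcongr; exact b.norm_coe_le_norm n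

instance cOmega_isClosed : IsClosed (cOmega A ω : Set (ℕ →ᵇ A)) := by
  rw [← isSeqClosed_iff_isClosed]
  intro u a hu hua
  change a ∈ cOmega A ω
  rw [mem_cOmega, Metric.tendsto_nhds]
  intro ε hε
  obtain ⟨k, hk⟩ := ((Metric.tendsto_nhds.mp hua) (ε / 2) (by positivity)).exists
  have h := (Metric.tendsto_nhds.mp (mem_cOmega.mp (hu k))) (ε / 2) (by positivity)
  filter_upwards [h] with n hn
  simp only [dist_zero_right, norm_norm] at hn ⊢
  have h1 : ‖a n - u k n‖ < ε / 2 := by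
    rw [← dist_eq_norm, dist_comm]
    exact lt_of_le_of_lt (BoundedContinuousFunction.dist_coe_le_dist n) hk
  calc ‖a n‖ = ‖(a n - u k n) + u k n‖ := by simp
    _ ≤ ‖a n - u k n‖ + ‖u k n‖ := norm_add_le _ _
    _ < ε := by linarith

theorem star_mem_cOmega {a : ℕ →ᵇ A} (ha : a ∈ cOmega A ω) : star a ∈ cOmega A ω := by
  rw [mem_cOmega] at ha ⊢
  simpa using ha

variable (A ω) in
/-- The ultrapower `A_ω = ℓ^∞(ℕ, A) / c_ω(ℕ, A)`. -/
def Ultrapower : Type _ := (ℕ →ᵇ A) ⧸ cOmega A ω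

namespace Ultrapower

instance : Ring (Ultrapower A ω) := inferInstanceAs (Ring ((ℕ →ᵇ A) ⧸ cOmega A ω))

instance : Algebra ℂ (Ultrapower A ω) := inferInstanceAs (Algebra ℂ ((ℕ →ᵇ A) ⧸ cOmega A ω))

instance : NormedAddCommGroup (Ultrapower A ω) :=
  inferInstanceAs (NormedAddCommGroup ((ℕ →ᵇ A) ⧸ cOmega A ω))

instance : CompleteSpace (Ultrapower A ω) :=
  inferInstanceAs (CompleteSpace ((ℕ →ᵇ A) ⧸ cOmega A ω))

variable (A ω) in
/-- The quotient map `π_ω : ℓ^∞(ℕ, A) → A_ω`. -/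
def mk : (ℕ →ᵇ A) →ₐ[ℂ] Ultrapower A ω := Ideal.Quotient.mkₐ ℂ (cOmega A ω)

theorem mk_surjective : Function.Surjective (mk A ω) := Ideal.Quotient.mk_surjective

theorem mk_eq_mk {a b : ℕ →ᵇ A} : mk A ω a = mk A ω b ↔ a - b ∈ cOmega A ω :=
  Ideal.Quotient.mk_eq_mk_iff_sub_mem a b

theorem eventually_norm_lt {a : ℕ →ᵇ A} {r : ℝ} (h : ‖mk A ω a‖ < r) :
    ∀ᶠ n in (ω : Filter ℕ), ‖a n‖ < r := by
  obtain ⟨b, hb, hbr⟩ := (QuotientAddGroup.norm_lt_iff (S := (cOmega A ω).toAddSubgroup)).mp h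
  have hab : a - b ∈ cOmega A ω := mk_eq_mk.mp hb.symm
  have := (Metric.tendsto_nhds.mp (mem_cOmega.mp hab)) (r - ‖b‖) (by linarith)
  filter_upwards [this] with n hn
  simp only [dist_zero_right, norm_norm] at hn
  calc ‖a n‖ = ‖(a - b) n + b n‖ := by simp
    _ ≤ ‖(a - b) n‖ + ‖b n‖ := norm_add_le _ _
    _ < r := by linarith [b.norm_coe_le_norm n]

theorem norm_le_of_eventually {a : ℕ →ᵇ A} {r : ℝ} (hr : 0 ≤ r)
    (h : ∀ᶠ n in (ω : Filter ℕ), ‖a n‖ ≤ r) : ‖mk A ω a‖ ≤ r := by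
  classical
  let b : ℕ →ᵇ A := BoundedContinuousFunction.ofNormedAddCommGroup
    (fun n => if ‖a n‖ ≤ r then a n else 0) continuous_of_discreteTopology r (by
      intro n
      split_ifs with hn
      · exact hn
      · simpa using hr)
  have hab : mk A ω a = mk A ω b := by
    rw [mk_eq_mk, mem_cOmega]
    refine tendsto_const_nhds.congr' ?_
    filter_upwards [h] with n hn
    simp [b, hn]
  rw [hab]
  refine (Submodule.Quotient.norm_mk_le (S := cOmega A ω) b).trans ?_
  refine (BoundedContinuousFunction.norm_le hr).mpr fun n => ?_
  change ‖if ‖a n‖ ≤ r then a n else 0‖ ≤ r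
  split_ifs with hn
  · exact hn
  · simpa using hr

/-- The norm of `A_ω` is `‖[(a n)]‖ = lim_ω ‖a n‖`. -/
theorem tendsto_norm (a : ℕ →ᵇ A) : Tendsto (fun n => ‖a n‖) ω (𝓝 ‖mk A ω a‖) := by
  rw [tendsto_order]
  refine ⟨fun r hr => ?_, fun r hr => eventually_norm_lt hr⟩
  by_contra hcon
  have h : ∀ᶠ n in (ω : Filter ℕ), ‖a n‖ ≤ r := by
    have := Ultrafilter.eventually_not.mpr hcon
    simpa using this
  obtain ⟨n, hn⟩ := h.exists
  exact absurd (norm_le_of_eventually ((norm_nonneg _).trans hn) h) (not_le.mpr hr)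

theorem norm_mk_eq_of_tendsto {a : ℕ →ᵇ A} {r : ℝ}
    (h : Tendsto (fun n => ‖a n‖) ω (𝓝 r)) : ‖mk A ω a‖ = r :=
  tendsto_nhds_unique (tendsto_norm a) h

instance : Star (Ultrapower A ω) where
  star := Quotient.map' star (by
    intro a b h
    have h' := (Submodule.quotientRel_def (cOmega A ω)).mp h
    refine (Submodule.quotientRel_def (cOmega A ω)).mpr ?_
    rw [← star_sub]
    exact star_mem_cOmega h')

theorem star_mk (a : ℕ →ᵇ A) : star (mk A ω a) = mk A ω (star a) := rfl

instance : StarRing (Ultrapower A ω) where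
  star_involutive x := by
    obtain ⟨a, rfl⟩ := mk_surjective x
    simp [star_mk]
  star_mul x y := by
    obtain ⟨a, rfl⟩ := mk_surjective x
    obtain ⟨b, rfl⟩ := mk_surjective y
    simp only [star_mk, ← map_mul, star_mul]
  star_add x y := by
    obtain ⟨a, rfl⟩ := mk_surjective x
    obtain ⟨b, rfl⟩ := mk_surjective y
    simp only [star_mk, ← map_add, star_add]

instance : StarModule ℂ (Ultrapower A ω) where
  star_smul c x := by
    obtain ⟨a, rfl⟩ := mk_surjective x
    simp only [star_mk, ← map_smul, star_smul]

instance : NormedRing (Ultrapower A ω) where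
  __ := (inferInstance : NormedAddCommGroup (Ultrapower A ω))
  __ := (inferInstance : Ring (Ultrapower A ω))
  norm_mul_le x y := by
    obtain ⟨a, rfl⟩ := mk_surjective x
    obtain ⟨b, rfl⟩ := mk_surjective y
    rw [← map_mul]
    exact le_of_tendsto_of_tendsto' (tendsto_norm (a * b))
      ((tendsto_norm a).mul (tendsto_norm b)) fun n => norm_mul_le (a n) (b n)

instance : NormedAlgebra ℂ (Ultrapower A ω) where
  norm_smul_le c x := by
    obtain ⟨a, rfl⟩ := mk_surjective x
    rw [← map_smul]
    exact le_of_tendsto_of_tendsto' (tendsto_norm (c • a))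
      ((tendsto_norm a).const_mul ‖c‖) fun n => norm_smul_le c (a n)

instance : CStarRing (Ultrapower A ω) where
  norm_mul_self_le x := by
    obtain ⟨a, rfl⟩ := mk_surjective x
    rw [star_mk, ← map_mul]
    refine le_of_eq ?_
    refine tendsto_nhds_unique ((tendsto_norm a).mul (tendsto_norm a)) ?_
    refine (tendsto_norm (star a * a)).congr fun n => ?_
    exact CStarRing.norm_star_mul_self (x := a n)

instance : CStarAlgebra (Ultrapower A ω) where

instance : PartialOrder (Ultrapower A ω) := CStarAlgebra.spectralOrder _

instance : StarOrderedRing (Ultrapower A ω) := CStarAlgebra.spectralOrderedRing _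

variable (A ω) in
/-- The embedding `ι : A → A_ω` as constant sequences. -/
def const : A →⋆ₐ[ℂ] Ultrapower A ω where
  toFun a := mk A ω (BoundedContinuousFunction.const ℕ a)
  map_one' := map_one (mk A ω)
  map_mul' a b := map_mul (mk A ω) (BoundedContinuousFunction.const ℕ a)
    (BoundedContinuousFunction.const ℕ b)
  map_zero' := map_zero (mk A ω)
  map_add' a b := map_add (mk A ω) (BoundedContinuousFunction.const ℕ a)
    (BoundedContinuousFunction.const ℕ b)
  commutes' c := (mk A ω).commutes c
  map_star' _ := rfl

variable (A ω) in
/-- The central ultrapower algebra `A_ω ∩ A'`. -/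
def central : StarSubalgebra ℂ (Ultrapower A ω) :=
  StarSubalgebra.centralizer ℂ (Set.range (const A ω))

theorem mem_central {x : Ultrapower A ω} :
    x ∈ central A ω ↔ ∀ a : A, const A ω a * x = x * const A ω a := by
  simp only [central, StarSubalgebra.mem_centralizer_iff, Set.forall_mem_range]
  refine ⟨fun h a => (h a).1, fun h a => ⟨h a, ?_⟩⟩
  rw [← map_star]
  exact h (star a)

/-- A `*`-homomorphism applied termwise to a bounded sequence. -/
def mapSeq (φ : A →⋆ₐ[ℂ] A) (a : ℕ →ᵇ A) : ℕ →ᵇ A :=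
  BoundedContinuousFunction.ofNormedAddCommGroup (fun n => φ (a n))
    continuous_of_discreteTopology ‖a‖
    fun n => (NonUnitalStarAlgHom.norm_apply_le φ (a n)).trans (a.norm_coe_le_norm n)

@[simp] theorem mapSeq_apply (φ : A →⋆ₐ[ℂ] A) (a : ℕ →ᵇ A) (n : ℕ) :
    mapSeq φ a n = φ (a n) := rfl

theorem mapSeq_mem (φ : A →⋆ₐ[ℂ] A) {a : ℕ →ᵇ A} (ha : a ∈ cOmega A ω) :
    mapSeq φ a ∈ cOmega A ω :=
  squeeze_zero (fun _ => norm_nonneg _)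
    (fun n => NonUnitalStarAlgHom.norm_apply_le φ (a n)) (mem_cOmega.mp ha)

variable (ω) in
/-- The endomorphism `[(a n)] ↦ [(φ (a n))]` of `A_ω` induced by an endomorphism `φ` of `A`. -/
def map (φ : A →⋆ₐ[ℂ] A) : Ultrapower A ω →⋆ₐ[ℂ] Ultrapower A ω where
  toFun := Quotient.map' (mapSeq φ) (by
    intro a b h
    have h' := (Submodule.quotientRel_def (cOmega A ω)).mp h
    refine (Submodule.quotientRel_def (cOmega A ω)).mpr ?_
    have : mapSeq φ a - mapSeq φ b = mapSeq φ (a - b) := by ext n; simp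
    rw [this]
    exact mapSeq_mem φ h')
  map_one' := congrArg (mk A ω) (show mapSeq φ 1 = 1 by ext n; simp)
  map_zero' := congrArg (mk A ω) (show mapSeq φ 0 = 0 by ext n; simp)
  map_mul' x y := by
    obtain ⟨a, rfl⟩ := mk_surjective x
    obtain ⟨b, rfl⟩ := mk_surjective y
    exact congrArg (mk A ω) (show mapSeq φ (a * b) = mapSeq φ a * mapSeq φ b by ext n; simp)
  map_add' x y := by
    obtain ⟨a, rfl⟩ := mk_surjective x
    obtain ⟨b, rfl⟩ := mk_surjective y
    exact congrArg (mk A ω) (show mapSeq φ (a + b) = mapSeq φ a + mapSeq φ b by ext n; simp)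
  commutes' c := congrArg (mk A ω)
    (show mapSeq φ (algebraMap ℂ (ℕ →ᵇ A) c) = algebraMap ℂ (ℕ →ᵇ A) c by
      ext n; simp [BoundedContinuousFunction.algebraMap_apply])
  map_star' x := by
    obtain ⟨a, rfl⟩ := mk_surjective x
    exact congrArg (mk A ω) (show mapSeq φ (star a) = star (mapSeq φ a) by ext n; simp [map_star])

@[simp] theorem map_mk (φ : A →⋆ₐ[ℂ] A) (a : ℕ →ᵇ A) :
    map ω φ (mk A ω a) = mk A ω (mapSeq φ a) := rfl

variable (ω) in
/-- The automorphism of `A_ω` induced by an automorphism of `A`. -/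
def mapEquiv (θ : A ≃⋆ₐ[ℂ] A) : Ultrapower A ω ≃⋆ₐ[ℂ] Ultrapower A ω where
  toFun := map ω (θ : A →⋆ₐ[ℂ] A)
  invFun := map ω (θ.symm : A →⋆ₐ[ℂ] A)
  left_inv x := by
    obtain ⟨a, rfl⟩ := mk_surjective x
    exact congrArg (mk A ω) (by ext n; simp)
  right_inv x := by
    obtain ⟨a, rfl⟩ := mk_surjective x
    exact congrArg (mk A ω) (by ext n; simp)
  map_mul' x y := map_mul _ x y
  map_add' x y := map_add _ x y
  map_star' x := map_star _ x
  map_smul' c x := map_smul _ c x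

variable {G : Type*} [Group G]

variable (ω) in
/-- The action `α_ω` of `G` on `A_ω` induced by an action `α` of `G` on `A`. -/
def action (α : G →* (A ≃⋆ₐ[ℂ] A)) : G →* (Ultrapower A ω ≃⋆ₐ[ℂ] Ultrapower A ω) where
  toFun g := mapEquiv ω (α g)
  map_one' := by
    ext x
    obtain ⟨a, rfl⟩ := mk_surjective x
    exact congrArg (mk A ω) (by ext n; simp)
  map_mul' g h := by
    ext x
    obtain ⟨a, rfl⟩ := mk_surjective x
    exact congrArg (mk A ω) (by ext n; simp)

end Ultrapower

end Ultrapower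

/-! ## The C⋆-algebra `C(X) ⊗ A`

For a compact space `X` the C⋆-tensor product `C(X) ⊗ A` is the algebra `C(X, A)` of continuous
functions `X → A`, with `f ⊗ a` the function `x ↦ f x • a`. -/

section TensorProduct

variable {X A : Type*} [TopologicalSpace X] [CStarAlgebra A]

/-- The elementary tensor `f ⊗ a` in `C(X) ⊗ A = C(X, A)`. -/
def elemTensor (f : C(X, ℂ)) (a : A) : C(X, A) := ⟨fun x => f x • a, by fun_prop⟩

variable (X A) in
/-- The canonical linear map from the algebraic tensor product of `C(X)` and `A` to `C(X, A)`. -/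
def tensorToContinuousMap : C(X, ℂ) ⊗[ℂ] A →ₗ[ℂ] C(X, A) :=
  TensorProduct.lift (LinearMap.mk₂ ℂ elemTensor
    (fun f f' a => by ext x; simp [elemTensor, add_smul])
    (fun c f a => by ext x; simp [elemTensor, mul_smul])
    (fun f a a' => by ext x; simp [elemTensor])
    (fun c f a => by ext x; simp [elemTensor, smul_comm c]))

/-- For a finite discrete space the algebraic tensor product is already all of `C(X, A)`. -/
theorem tensorToContinuousMap_bijective [DiscreteTopology X] [Finite X] :
    Function.Bijective (tensorToContinuousMap X A) := by
  classical
  cases nonempty_fintype X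
  let δ : X → C(X, ℂ) := fun x => ⟨fun y => if y = x then 1 else 0, continuous_of_discreteTopology⟩
  let s : C(X, A) → C(X, ℂ) ⊗[ℂ] A := fun F => ∑ x, δ x ⊗ₜ[ℂ] F x
  refine Function.bijective_iff_has_inverse.mpr ⟨s, fun t => ?_, fun F => ?_⟩
  · induction t using TensorProduct.induction_on with
    | zero => simp [s]
    | add t u ht hu =>
      have hs : ∀ F F' : C(X, A), s (F + F') = s F + s F' := fun F F' => by
        simp [s, TensorProduct.tmul_add, Finset.sum_add_distrib]
      rw [map_add, hs, ht, hu]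
    | tmul f a =>
      have hf : f = ∑ x, f x • δ x := by
        ext y
        simp [δ, ContinuousMap.sum_apply]
      have : s (tensorToContinuousMap X A (f ⊗ₜ[ℂ] a)) = ∑ x, δ x ⊗ₜ[ℂ] (f x • a) := rfl
      rw [this]
      conv_rhs => rw [hf, TensorProduct.sum_tmul]
      exact Finset.sum_congr rfl fun x _ => by rw [TensorProduct.smul_tmul]
  · ext y
    simp [s, tensorToContinuousMap, elemTensor, δ, ContinuousMap.sum_apply]

theorem exists_eq_star_mul_self_of_isUnit {B : Type*} [CStarAlgebra B] {f : B}
    (hf : IsSelfAdjoint f) (h : ∀ r : ℝ, r < 0 → IsUnit (algebraMap ℂ B r - f)) :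
    ∃ s, f = star s * s := by
  have hspec : ∀ r ∈ spectrum ℝ f, 0 ≤ r := by
    intro r hr
    by_contra hr0
    exact hr (h r (not_le.mp hr0))
  refine ⟨cfc Real.sqrt f, ?_⟩
  have hs : star (cfc Real.sqrt f) = cfc Real.sqrt f :=
    (cfc_predicate Real.sqrt f : IsSelfAdjoint _).star_eq
  rw [hs, ← cfc_mul Real.sqrt Real.sqrt f]
  conv_lhs => rw [← cfc_id ℝ f]
  exact cfc_congr fun r hr => (Real.mul_self_sqrt (hspec r hr)).symm

/-- The positive elements of `C(X, A)` are the pointwise positive functions. -/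
instance ContinuousMap.starOrderedRing_of_cstarAlgebra [CompactSpace X] [PartialOrder A]
    [StarOrderedRing A] : StarOrderedRing C(X, A) := by
  refine StarOrderedRing.of_nonneg_iff' ?_ ?_
  · intro f g hfg h x
    simpa using add_le_add_right (hfg x) (h x)
  · intro f
    constructor
    · intro hf
      have hsa : IsSelfAdjoint f := by
        ext x
        exact IsSelfAdjoint.of_nonneg (hf x)
      refine exists_eq_star_mul_self_of_isUnit hsa fun r hr => ?_
      refine (ContinuousMap.isUnit_iff_forall_isUnit _).mpr fun x => ?_
      by_contra hx
      exact absurd (spectrum_nonneg_of_nonneg (𝕜 := ℝ) (hf x) hx) (not_le.mpr hr)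
    · rintro ⟨s, rfl⟩ x
      exact star_mul_self_nonneg (s x)

variable (X) in
/-- The second factor embedding `1 ⊗ id : A → C(X) ⊗ A`. -/
def oneTensor : A →⋆ₐ[ℂ] C(X, A) where
  toFun a := elemTensor 1 a
  map_one' := by ext x; simp [elemTensor]
  map_mul' a b := by ext x; simp [elemTensor]
  map_zero' := by ext x; simp [elemTensor]
  map_add' a b := by ext x; simp [elemTensor]
  commutes' c := by ext x; simp [elemTensor, Algebra.algebraMap_eq_smul_one]
  map_star' a := by ext x; simp [elemTensor]

theorem continuous_starAlgEquiv (θ : A ≃⋆ₐ[ℂ] A) : Continuous θ :=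
  AddMonoidHomClass.continuous_of_bound θ 1 fun a => by
    simpa using NonUnitalStarAlgHom.norm_apply_le θ a

variable {G : Type*} [Group G] [TopologicalSpace G] [IsTopologicalGroup G]

/-- The action `σ ⊗ α` of `G` on `C(G) ⊗ A = C(G, A)`, where `σ_g f = f (g⁻¹ ·)` is the shift. -/
def shiftTensor (α : G →* (A ≃⋆ₐ[ℂ] A)) :
    G →* (C(G, A) ≃⋆ₐ[ℂ] C(G, A)) where
  toFun g :=
    { toFun := fun F => ⟨fun k => α g (F (g⁻¹ * k)), by have := continuous_starAlgEquiv (α g); fun_prop⟩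
      invFun := fun F => ⟨fun k => α g⁻¹ (F (g * k)), by have := continuous_starAlgEquiv (α g⁻¹); fun_prop⟩
      left_inv := fun F => by
        ext k
        change α g⁻¹ (α g (F (g⁻¹ * (g * k)))) = F k
        rw [← StarAlgEquiv.mul_apply, ← map_mul]
        simp
      right_inv := fun F => by
        ext k
        change α g (α g⁻¹ (F (g * (g⁻¹ * k)))) = F k
        rw [← StarAlgEquiv.mul_apply, ← map_mul]
        simp
      map_mul' := fun F F' => by ext k; simp
      map_add' := fun F F' => by ext k; simp
      map_star' := fun F => by ext k; simp [map_star]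
      map_smul' := fun c F => by ext k; simp }
  map_one' := by ext F k; simp
  map_mul' g h := by ext F k; simp [mul_assoc]

/-- The shift `σ_g f = f (g⁻¹ ·)` on `C(G)`. -/
def shift (g : G) (f : C(G, ℂ)) : C(G, ℂ) := ⟨fun k => f (g⁻¹ * k), by fun_prop⟩

theorem shiftTensor_elemTensor (α : G →* (A ≃⋆ₐ[ℂ] A)) (g : G) (f : C(G, ℂ)) (a : A) :
    shiftTensor α g (elemTensor f a) = elemTensor (shift g f) (α g a) := by
  ext k
  exact map_smul (α g) (f (g⁻¹ * k)) a

end TensorProduct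

/-! ## Sequentially split maps and the generalized tracial Rokhlin property -/

section Main

variable {G A B : Type*} [Group G] [CStarAlgebra A] [CStarAlgebra B]

/-- An equivariant `*`-homomorphism `(A, α) → (B, β)`. -/
structure EquivariantStarHom (α : G →* (A ≃⋆ₐ[ℂ] A)) (β : G →* (B ≃⋆ₐ[ℂ] B)) extends
    A →⋆ₙₐ[ℂ] B where
  map_action' : ∀ (h : G) (a : A), toFun (α h a) = β h (toFun a)

/-- An equivariant `*`-homomorphism `φ : (A, α) → (B, β)` is `G`-tracially sequentially-split by
order zero if for every nonzero positive `x ∈ A_ω` there are an equivariant order zero map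
`ψ : (B, β) → (A_ω, α_ω)` and a nonzero positive `g ∈ A_ω ∩ A'` such that
`ψ (φ a) = g a = a g` for all `a ∈ A`, and `1 - g ≲ x`. -/
def EquivariantStarHom.IsTraciallySequentiallySplitByOrderZero (ω : Ultrafilter ℕ)
    [PartialOrder B] [StarOrderedRing B] {α : G →* (A ≃⋆ₐ[ℂ] A)} {β : G →* (B ≃⋆ₐ[ℂ] B)}
    (φ : EquivariantStarHom α β) : Prop :=
  ∀ x : Ultrapower A ω, 0 ≤ x → x ≠ 0 →
    ∃ ψ : B →CP Ultrapower A ω,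
      ψ.IsOrderZero ∧
      (∀ (h : G) (b : B), ψ (β h b) = Ultrapower.action ω α h (ψ b)) ∧
      ∃ g ∈ Ultrapower.central A ω, 0 ≤ g ∧ g ≠ 0 ∧
        (∀ a : A, ψ (φ.toFun a) = g * Ultrapower.const A ω a ∧
          ψ (φ.toFun a) = Ultrapower.const A ω a * g) ∧
        CuntzSubequiv (1 - g) x

/-- The generalized tracial Rokhlin property of Hirshberg and Orovitz. A normalized positive
contraction is a positive element of norm one. -/
def HasGeneralizedTracialRokhlinProperty [Fintype G] [PartialOrder A] [StarOrderedRing A]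
    (α : G →* (A ≃⋆ₐ[ℂ] A)) : Prop :=
  ∀ (F : Finset A) (ε : ℝ) (x : A), 0 < ε → 0 ≤ x → x ≠ 0 →
    ∃ e : G → A,
      (∀ g, 0 ≤ e g ∧ ‖e g‖ = 1) ∧
      (∀ g h, g ≠ h → e g * e h = 0) ∧
      (∀ g h, ‖α g (e h) - e (g * h)‖ ≤ ε) ∧
      (∀ g, ∀ a ∈ F, ‖e g * a - a * e g‖ ≤ ε) ∧
      CuntzSubequiv (1 - ∑ g, e g) x

/-- The second factor embedding `1 ⊗ id : (A, α) → (C(G) ⊗ A, σ ⊗ α)` as an equivariant map. -/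
def equivariantOneTensor [TopologicalSpace G] [IsTopologicalGroup G] [CompactSpace G]
    (α : G →* (A ≃⋆ₐ[ℂ] A)) : EquivariantStarHom α (shiftTensor α) where
  toNonUnitalStarAlgHom := (oneTensor G : A →⋆ₐ[ℂ] C(G, A)).toNonUnitalStarAlgHom
  map_action' h a := by
    ext k
    change (1 : ℂ) • α h a = α h ((1 : ℂ) • a)
    simp

end Main

end

/-! ## Cuntz subequivalence -/

section Cuntz

variable {A : Type*} [CStarAlgebra A]

/-! Both properties describe one object: a family of pairwise orthogonal positive elements `f h` of
`A_ω ∩ A'`, permuted by the action, whose sum `g` leaves a remainder `1 - g` that is Cuntz-small.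
With `δ_h` the point mass at `h`, a splitting `ψ` yields `f h = ψ (δ_h ⊗ 1)`, and a family yields `ψ
F = ∑ h, F h * f h` (`weightedEval`). What remains is to pass between families in `A_ω` and families
in `A`.

From splitting to Rokhlin: the `f h` commute with `A` because `ψ (δ_h ⊗ a) ≤ ‖a‖ • f h` for `a ≥ 0`,
which forces `ψ (δ_h ⊗ a) = a * f h` (`commute_of_sum_eq`); the structure theorem for order zero
maps is not needed. After rescaling to norm one, the family is lifted approximately to exactly
orthogonal bounded sequences (`exists_orthogonal_lift`), and a suitable term is truncated by `clip`
to norm exactly one. Truncation also turns an approximate bound on the remainder into an exact Cuntz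
subequivalence (`cuntzSubequiv_one_sub_sum_clip`).

From Rokhlin to splitting: separability lets a sequence of Rokhlin families, for growing finite sets
and shrinking tolerances, define a central family in `A_ω`. The delicate point is that the elements
witnessing the Cuntz subequivalences must be bounded in order to define an element of `A_ω`. For
this a lift `y n` of `x` is replaced by its cut-down `(y n - k)₊`, which gives a bound depending
only on `k` and the order of `G` (`exists_norm_le_of_cuntzSubequiv_sub_clip`). -/

theorem cuntzSubequiv_iff {a b : A} :
    CuntzSubequiv a b ↔ ∀ ε : ℝ, 0 < ε → ∃ r : A, ‖r * b * star r - a‖ < ε := by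
  constructor
  · rintro ⟨x, hx⟩ ε hε
    obtain ⟨n, hn⟩ := ((tendsto_order.mp hx).2 ε hε).exists
    exact ⟨x n, hn⟩
  · intro h
    choose r hr using fun n : ℕ => h (1 / ((n : ℝ) + 1)) (by positivity)
    exact ⟨r, squeeze_zero (fun _ => norm_nonneg _) (fun n => (hr n).le)
      tendsto_one_div_add_atTop_nhds_zero_nat⟩

theorem CuntzSubequiv.trans {a b c : A} (hab : CuntzSubequiv a b) (hbc : CuntzSubequiv b c) :
    CuntzSubequiv a c := by
  rw [cuntzSubequiv_iff] at *
  intro ε hε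
  obtain ⟨r, hr⟩ := hab (ε / 2) (by positivity)
  obtain ⟨s, hs⟩ := hbc (ε / (2 * (‖r‖ * ‖r‖ + 1))) (by positivity)
  refine ⟨r * s, ?_⟩
  have key : r * s * c * star (r * s) - a
      = r * (s * c * star s - b) * star r + (r * b * star r - a) := by
    rw [star_mul]; noncomm_ring
  have h1 : ‖r * (s * c * star s - b) * star r‖ ≤ ‖r‖ * ‖r‖ * ‖s * c * star s - b‖ := by
    calc _ ≤ ‖r * (s * c * star s - b)‖ * ‖star r‖ := norm_mul_le _ _
      _ ≤ ‖r‖ * ‖s * c * star s - b‖ * ‖star r‖ := by gcongr; exact norm_mul_le _ _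
      _ = _ := by rw [norm_star]; ring
  have h2 : ‖r‖ * ‖r‖ * ‖s * c * star s - b‖ ≤ ε / 2 := by
    calc _ ≤ (‖r‖ * ‖r‖ + 1) * (ε / (2 * (‖r‖ * ‖r‖ + 1))) := by gcongr; linarith
      _ = ε / 2 := by field_simp
  rw [key]
  linarith [norm_add_le (r * (s * c * star s - b) * star r) (r * b * star r - a)]

theorem cuntzSubequiv_conj (r b : A) : CuntzSubequiv (r * b * star r) b :=
  cuntzSubequiv_iff.mpr fun ε hε => ⟨r, by simpa⟩

variable [PartialOrder A] [StarOrderedRing A]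

/-- Serves to extract `g ≤ 1` from `1 - g ≲ x`. -/
theorem CuntzSubequiv.nonneg {a b : A} (hb : 0 ≤ b) (h : CuntzSubequiv a b) : 0 ≤ a := by
  obtain ⟨x, hx⟩ := h
  have : Tendsto (fun n => x n * b * star (x n)) atTop (𝓝 a) :=
    tendsto_iff_norm_sub_tendsto_zero.mpr hx
  exact ge_of_tendsto' this fun n => star_right_conjugate_nonneg hb _

/-- With `s = √a` and `w = (b + δ)^(-1/2)` one has `w b w = 1 - δ w²`, so `s w b w s` differs from
`a` by `δ s w² s`. The norm of `s w² s` is that of `w a w ≤ w b w ≤ 1`. -/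
theorem cuntzSubequiv_of_le {a b : A} (ha : 0 ≤ a) (hab : a ≤ b) : CuntzSubequiv a b := by
  rw [cuntzSubequiv_iff]
  intro ε hε
  have hb : 0 ≤ b := ha.trans hab
  set δ := ε / 2 with hδ
  have hδ0 : 0 < δ := by positivity
  -- Replacing `t` by `max t 0` changes nothing on the spectrum of `b` and makes the function
  -- continuous on all of `ℝ`.
  have hpos : ∀ t : ℝ, 0 < max t 0 + δ := fun t => by positivity
  have hcont : Continuous fun t : ℝ => (√(max t 0 + δ))⁻¹ :=
    Continuous.inv₀ (by fun_prop) fun t => (Real.sqrt_pos.mpr (hpos t)).ne'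
  set w := cfc (fun t : ℝ => (√(max t 0 + δ))⁻¹) b with hw
  have hwsa : IsSelfAdjoint w := cfc_predicate _ b
  set s := cfc Real.sqrt a with hs
  have hssa : IsSelfAdjoint s := cfc_predicate _ a
  have hss : s * s = a := by
    rw [hs, ← cfc_mul Real.sqrt Real.sqrt a]
    conv_rhs => rw [← cfc_id ℝ a]
    exact cfc_congr fun r hr => Real.mul_self_sqrt (spectrum_nonneg_of_nonneg ha hr)
  have hwbw : w * b * w = 1 - δ • (w * w) := by
    have h1 : w * b * w + δ • (w * w) = 1 := by
      have hid : w * b * w = w * cfc (fun t : ℝ => t) b * w := by rw [cfc_id' ℝ b]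
      rw [hid, hw, ← cfc_mul _ _ b hcont.continuousOn, ← cfc_mul _ _ b (by fun_prop)
        hcont.continuousOn, ← cfc_mul _ _ b hcont.continuousOn hcont.continuousOn,
        ← cfc_smul δ _ b (by fun_prop), ← cfc_add b _ _ (by fun_prop) (by fun_prop),
        ← cfc_one ℝ b]
      refine cfc_congr fun t ht => ?_
      have ht0 : 0 ≤ t := spectrum_nonneg_of_nonneg hb ht
      have h2 : √(max t 0 + δ) * √(max t 0 + δ) = t + δ := by
        rw [Real.mul_self_sqrt (hpos t).le, max_eq_left ht0]
      have h3 := (Real.sqrt_pos.mpr (hpos t)).ne'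
      simp only [smul_eq_mul, Pi.one_apply]
      field_simp
      linarith
    exact eq_sub_of_add_eq h1
  have hwbw_le : ‖w * b * w‖ ≤ 1 := by
    have h0 : 0 ≤ w * b * w := hwsa.conjugate_nonneg hb
    rw [CStarAlgebra.norm_le_one_iff_of_nonneg _ h0, hwbw]
    refine sub_le_self _ (smul_nonneg hδ0.le ?_)
    simpa [hwsa.star_eq] using star_mul_self_nonneg w
  refine ⟨s * w, ?_⟩
  have key : s * w * b * star (s * w) - a = -(δ • (s * w * star (s * w))) := by
    rw [star_mul, hssa.star_eq, hwsa.star_eq]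
    calc s * w * b * (w * s) - a = s * (w * b * w) * s - s * s := by rw [hss]; noncomm_ring
      _ = -(δ • (s * w * (w * s))) := by
        rw [hwbw, mul_sub, sub_mul, mul_one, mul_smul_comm, smul_mul_assoc]
        simp [mul_assoc]
  have hn : ‖s * w * star (s * w)‖ ≤ 1 := by
    rw [CStarRing.norm_self_mul_star, ← CStarRing.norm_star_mul_self, star_mul, hssa.star_eq,
      hwsa.star_eq]
    have : w * s * (s * w) = w * a * w := by rw [← hss]; noncomm_ring
    rw [this]
    exact (CStarAlgebra.norm_le_norm_of_nonneg_of_le (hwsa.conjugate_nonneg ha)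
      (hwsa.conjugate_le_conjugate hab)).trans hwbw_le
  rw [key, norm_neg, norm_smul, Real.norm_of_nonneg hδ0.le]
  nlinarith [norm_nonneg (s * w * star (s * w))]

/-- Conjugating `c ^ 3` by the regularized inverse `(c + δ)⁻¹` gives `t ^ 3 / (t + δ) ^ 2`, which is
within `3 * δ` of `t` for `t ≥ 0`. -/
theorem cuntzSubequiv_pow_three {c : A} (hc : 0 ≤ c) : CuntzSubequiv c (c ^ 3) := by
  rw [cuntzSubequiv_iff]
  intro ε hε
  set δ := ε / 4 with hδ
  have hδ0 : 0 < δ := by positivity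
  have hcont : Continuous fun t : ℝ => (max t 0 + δ)⁻¹ :=
    Continuous.inv₀ (by fun_prop) fun t => by positivity
  set r := cfc (fun t : ℝ => (max t 0 + δ)⁻¹) c with hr
  have hrsa : IsSelfAdjoint r := cfc_predicate _ c
  refine ⟨r, ?_⟩
  have key : r * c ^ 3 * star r - c
      = cfc (fun t : ℝ => (max t 0 + δ)⁻¹ * t ^ 3 * (max t 0 + δ)⁻¹ - t) c := by
    rw [cfc_sub _ _ c (by fun_prop) (by fun_prop),
      cfc_mul _ _ c (by fun_prop) hcont.continuousOn,
      cfc_mul _ _ c hcont.continuousOn (by fun_prop), cfc_pow_id c 3, cfc_id' ℝ c, hrsa.star_eq]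
  rw [key]
  refine lt_of_le_of_lt (norm_cfc_le (c := 3 * δ) (by positivity) fun t ht => ?_) (by linarith)
  have ht0 : 0 ≤ t := spectrum_nonneg_of_nonneg hc ht
  rw [max_eq_left ht0, Real.norm_eq_abs, abs_le]
  have h1 : (t + δ)⁻¹ * t ^ 3 * (t + δ)⁻¹ - t
      = -(t * (2 * t * δ + δ ^ 2) / (t + δ) ^ 2) := by
    field_simp
    ring
  have h2 : t * (2 * t * δ + δ ^ 2) / (t + δ) ^ 2 ≤ 3 * δ := by
    rw [div_le_iff₀ (by positivity)]
    nlinarith [mul_nonneg (mul_nonneg ht0 ht0) hδ0.le, mul_nonneg ht0 (sq_nonneg δ),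
      pow_pos hδ0 3]
  have h3 : 0 ≤ t * (2 * t * δ + δ ^ 2) / (t + δ) ^ 2 := by positivity
  rw [h1]
  constructor <;> linarith

end Cuntz

/-! ## Truncation of positive elements -/

section Clip

variable {A : Type*} [CStarAlgebra A]

theorem continuous_inv_max {k : ℝ} (hk : 0 < k) : Continuous fun t : ℝ => (max t k)⁻¹ :=
  Continuous.inv₀ (by fun_prop) fun t => (lt_max_of_lt_right hk).ne'

/-- `clip k b` is the function `min (t / k) 1` of a positive element `b`. -/
noncomputable def clip (k : ℝ) (b : A) : A := cfc (fun t : ℝ => t * (max t k)⁻¹) b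

theorem clip_isSelfAdjoint (k : ℝ) (b : A) : IsSelfAdjoint (clip k b) := cfc_predicate _ b

theorem clip_eq_mul {k : ℝ} (hk : 0 < k) {b : A} (hb : IsSelfAdjoint b) :
    clip k b = b * cfc (fun t : ℝ => (max t k)⁻¹) b := by
  have := continuous_inv_max hk
  rw [clip, cfc_mul _ _ b (by fun_prop) this.continuousOn, cfc_id' ℝ b]

theorem clip_eq_mul' {k : ℝ} (hk : 0 < k) {b : A} (hb : IsSelfAdjoint b) :
    clip k b = cfc (fun t : ℝ => (max t k)⁻¹) b * b := by
  rw [clip_eq_mul hk hb]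
  exact ((Commute.refl b).cfc_real _).symm.eq

theorem clip_mul_eq_zero {k : ℝ} (hk : 0 < k) {b c : A} (hb : IsSelfAdjoint b)
    (h : b * c = 0) : clip k b * c = 0 := by
  rw [clip_eq_mul' hk hb, mul_assoc, h, mul_zero]

theorem mul_clip_eq_zero {k : ℝ} (hk : 0 < k) {b c : A} (hc : IsSelfAdjoint c)
    (h : b * c = 0) : b * clip k c = 0 := by
  rw [clip_eq_mul hk hc, ← mul_assoc, h, zero_mul]

/-- The element `b - k • clip k b` is the cut-down `(b - k)₊`, in this form throughout. It lives
where `t > k`, and there the truncation equals `1`. -/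
theorem clip_mul_sub_clip {k : ℝ} (hk : 0 < k) {b : A} (hb : IsSelfAdjoint b) :
    clip k b * (b - k • clip k b) = b - k • clip k b := by
  have := continuous_inv_max hk
  nth_rewrite 2 4 [← cfc_id' ℝ b]
  rw [clip, ← cfc_smul k _ b (by fun_prop), ← cfc_sub _ _ b (by fun_prop) (by fun_prop),
    ← cfc_mul _ _ b (by fun_prop) (by fun_prop)]
  refine cfc_congr fun t _ => ?_
  have h0 : 0 < max t k := lt_max_of_lt_right hk
  simp only [smul_eq_mul]
  rcases le_total t k with h | h
  · simp only [max_eq_right h]; field_simp; ring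
  · rw [max_eq_left h] at h0 ⊢; field_simp

theorem map_clip {B F : Type*} [CStarAlgebra B] [FunLike F A B] [AlgHomClass F ℂ A B]
    [StarHomClass F A B] (π : F) {k : ℝ} (hk : 0 < k) {b : A} (hb : IsSelfAdjoint b) :
    π (clip k b) = clip k (π b) := by
  have := continuous_inv_max hk
  have hπ : Continuous π := AddMonoidHomClass.continuous_of_bound π 1 fun a => by
    simpa using NonUnitalStarAlgHom.norm_apply_le π a
  exact StarAlgHomClass.map_cfc (S := ℂ) π _ b (by fun_prop) hπ hb (hb.map π)

variable [PartialOrder A] [StarOrderedRing A]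

theorem clip_nonneg {k : ℝ} (hk : 0 < k) {b : A} (hb : 0 ≤ b) : 0 ≤ clip k b :=
  cfc_nonneg fun t ht => mul_nonneg (spectrum_nonneg_of_nonneg hb ht)
    (inv_nonneg.mpr (hk.le.trans (le_max_right t k)))

theorem norm_clip_le_one {k : ℝ} (hk : 0 < k) {b : A} (hb : 0 ≤ b) : ‖clip k b‖ ≤ 1 := by
  refine norm_cfc_le zero_le_one fun t ht => ?_
  have ht0 : 0 ≤ t := spectrum_nonneg_of_nonneg hb ht
  have h0 : 0 < max t k := lt_max_of_lt_right hk
  rw [Real.norm_of_nonneg (by positivity), ← div_eq_mul_inv, div_le_one h0]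
  exact le_max_left _ _

theorem norm_clip_eq_one [Nontrivial A] {k : ℝ} (hk : 0 < k) {b : A} (hb : 0 ≤ b)
    (h : k ≤ ‖b‖) : ‖clip k b‖ = 1 := by
  refine le_antisymm (norm_clip_le_one hk hb) ?_
  have := continuous_inv_max hk
  have h1 := norm_apply_le_norm_cfc (fun t : ℝ => t * (max t k)⁻¹) b
    (CStarAlgebra.norm_mem_spectrum_of_nonneg hb) (by fun_prop)
  rw [clip]
  simpa [max_eq_left h, mul_inv_cancel₀ (hk.trans_le h).ne'] using h1

theorem norm_sub_clip_le {k η : ℝ} (hk : 0 < k) {b : A} (hb : 0 ≤ b) (hη : 1 - η ≤ k)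
    (hkη : k ≤ 1 + η) (hbη : ‖b‖ ≤ 1 + η) : ‖b - clip k b‖ ≤ η := by
  have := continuous_inv_max hk
  have h0 : b - clip k b = cfc (fun t : ℝ => t - t * (max t k)⁻¹) b := by
    rw [cfc_sub _ _ b (by fun_prop) (by fun_prop), cfc_id' ℝ b, clip]
  rw [h0]
  refine norm_cfc_le (by linarith) fun t ht => ?_
  have ht0 : 0 ≤ t := spectrum_nonneg_of_nonneg hb ht
  have htb : t ≤ 1 + η := by
    rcases subsingleton_or_nontrivial A with hA | hA
    · exact absurd ht (by simp [spectrum.of_subsingleton])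
    · exact ((le_abs_self t).trans (spectrum.norm_le_norm_of_mem ht)).trans hbη
  have hm0 : 0 < max t k := lt_max_of_lt_right hk
  have hm1 : max t k ≤ 1 + η := max_le htb hkη
  have hm2 : 1 - η ≤ max t k := hη.trans (le_max_right _ _)
  -- The first factor is at most `1`, and `max t k` lies within `η` of `1`.
  have e : t - t * (max t k)⁻¹ = t / max t k * (max t k - 1) := by field_simp
  have h1 : t / max t k ≤ 1 := (div_le_one hm0).mpr (le_max_left _ _)
  have h2 : |max t k - 1| ≤ η := abs_le.mpr ⟨by linarith, by linarith⟩
  rw [e, norm_mul, Real.norm_of_nonneg (by positivity), Real.norm_eq_abs]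
  calc t / max t k * |max t k - 1| ≤ 1 * η := by gcongr
    _ = η := one_mul η

theorem sub_clip_nonneg {k : ℝ} (hk : 0 < k) {b : A} (hb : 0 ≤ b) : 0 ≤ b - k • clip k b := by
  have := continuous_inv_max hk
  have h0 : b - k • clip k b = cfc (fun t : ℝ => t - k • (t * (max t k)⁻¹)) b := by
    rw [cfc_sub _ _ b (by fun_prop) (by fun_prop), cfc_id' ℝ b,
      cfc_smul k _ b (by fun_prop), clip]
  rw [h0]
  refine cfc_nonneg fun t ht => ?_
  have ht0 : 0 ≤ t := spectrum_nonneg_of_nonneg hb ht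
  have hm0 : 0 < max t k := lt_max_of_lt_right hk
  have e : t - k • (t * (max t k)⁻¹) = t * (max t k - k) / max t k := by
    simp only [smul_eq_mul]; field_simp
  rw [e]
  have := sub_nonneg.mpr (le_max_right t k)
  positivity

theorem norm_smul_clip_le {k : ℝ} (hk : 0 < k) {b : A} (hb : 0 ≤ b) : ‖k • clip k b‖ ≤ k := by
  rw [norm_smul, Real.norm_of_nonneg hk.le]
  nlinarith [norm_clip_le_one hk hb]

theorem sub_clip_ne_zero {k : ℝ} (hk : 0 < k) {b : A} (hb : 0 ≤ b) (h : k < ‖b‖) :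
    b - k • clip k b ≠ 0 := by
  intro h0
  have h1 := norm_smul_clip_le hk hb
  rw [← sub_eq_zero.mp h0] at h1
  exact absurd h1 (not_le.mpr h)

/-- If `a` is approximated by `r (b - k)₊ r⋆`, it is approximated by `s b s⋆` with a bound on `s`
that depends only on `‖a‖` and `k`. -/
theorem exists_norm_le_of_cuntzSubequiv_sub_clip {k ε : ℝ} (hk : 0 < k) (hε : 0 < ε) {a b : A}
    (hb : 0 ≤ b) (h : CuntzSubequiv a (b - k • clip k b)) :
    ∃ s : A, ‖s * b * star s - a‖ < ε ∧ k * ‖s‖ ^ 2 ≤ ‖a‖ + ε := by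
  have hcont := continuous_inv_max hk
  obtain ⟨r, hr⟩ := cuntzSubequiv_iff.mp h ε hε
  have hpos : ∀ t : ℝ, 0 ≤ 1 - k * (max t k)⁻¹ := fun t => by
    have hm0 : 0 < max t k := lt_max_of_lt_right hk
    rw [sub_nonneg, ← div_eq_mul_inv, div_le_one hm0]
    exact le_max_right _ _
  have hc1 : Continuous fun t : ℝ => 1 - k * (max t k)⁻¹ :=
    continuous_const.sub (continuous_const.mul hcont)
  have hc : Continuous fun t : ℝ => √(1 - k * (max t k)⁻¹) := hc1.sqrt
  -- The choice of `q` gives both `q b q = (b - k)₊` and `k q² ≤ (b - k)₊`. Hence `s = r q` does the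
  -- job of `r`, and `k ‖r q‖² = ‖r (k q²) r⋆‖ ≤ ‖r (b - k)₊ r⋆‖ ≤ ‖a‖ + ε`.
  set q := cfc (fun t : ℝ => √(1 - k * (max t k)⁻¹)) b with hq
  have hqsa : IsSelfAdjoint q := cfc_predicate _ b
  have hqq : q * q = cfc (fun t : ℝ => 1 - k * (max t k)⁻¹) b := by
    rw [hq, ← cfc_mul _ _ b hc.continuousOn hc.continuousOn]
    exact cfc_congr fun t _ => Real.mul_self_sqrt (hpos t)
  have hcut : b - k • clip k b = cfc (fun t : ℝ => t * (1 - k * (max t k)⁻¹)) b := by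
    nth_rewrite 1 [← cfc_id' ℝ b]
    rw [clip, ← cfc_smul k _ b (by fun_prop), ← cfc_sub _ _ b (by fun_prop) (by fun_prop)]
    refine cfc_congr fun t _ => ?_
    simp only [smul_eq_mul]
    ring
  have hqbq : q * b * q = b - k • clip k b := by
    have hcomm : q * b = b * q := ((Commute.refl b).cfc_real _).eq
    rw [hcomm, mul_assoc, hqq, hcut, cfc_mul _ _ b (by fun_prop) hc1.continuousOn, cfc_id' ℝ b]
  have hle : k • (q * q) ≤ b - k • clip k b := by
    rw [hqq, hcut, ← cfc_smul k _ b hc1.continuousOn]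
    refine cfc_mono (fun t ht => ?_) (hc1.const_smul k).continuousOn
      (continuous_id.mul hc1).continuousOn
    have ht0 : 0 ≤ t := spectrum_nonneg_of_nonneg hb ht
    simp only [smul_eq_mul]
    rcases le_total t k with h | h
    · rw [max_eq_right h, mul_inv_cancel₀ hk.ne']; simp
    · exact mul_le_mul_of_nonneg_right h (hpos t)
  have hrr : r * q * b * star (r * q) = r * (b - k • clip k b) * star r := by
    rw [← hqbq, star_mul, hqsa.star_eq]
    noncomm_ring
  refine ⟨r * q, by rwa [hrr], ?_⟩
  have e1 : k * ‖r * q‖ ^ 2 = ‖r * (k • (q * q)) * star r‖ := by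
    rw [sq, ← CStarRing.norm_self_mul_star, star_mul, hqsa.star_eq, mul_smul_comm,
      smul_mul_assoc, norm_smul, Real.norm_of_nonneg hk.le]
    simp only [mul_assoc]
  have hqq0 : 0 ≤ q * q := by simpa [hqsa.star_eq] using star_mul_self_nonneg q
  have e2 : ‖r * (k • (q * q)) * star r‖ ≤ ‖r * (b - k • clip k b) * star r‖ :=
    CStarAlgebra.norm_le_norm_of_nonneg_of_le
      (star_right_conjugate_nonneg (smul_nonneg hk.le hqq0) r)
      (star_right_conjugate_le_conjugate hle r)
  have e3 := norm_add_le (r * (b - k • clip k b) * star r - a) a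
  rw [sub_add_cancel] at e3
  linarith

end Clip

/-! ## Families of orthogonal positive elements -/

section Orthogonal

variable {ι A : Type*} [CStarAlgebra A]

theorem sum_mul_of_orthogonal [Fintype ι] {e : ι → A}
    (horth : ∀ i j, i ≠ j → e i * e j = 0) (i : ι) : (∑ j, e j) * e i = e i * e i := by
  rw [Finset.sum_mul]
  exact Finset.sum_eq_single i (fun j _ hj => horth j i hj) (by simp)

variable [PartialOrder A] [StarOrderedRing A]

/-- For `E = ∑ e i`, orthogonality gives `E² = ∑ (e i)² ≤ E`, hence `‖E‖² ≤ ‖E‖`. -/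
theorem sum_le_one_of_orthogonal [Fintype ι] {e : ι → A} (he : ∀ i, 0 ≤ e i)
    (he1 : ∀ i, ‖e i‖ ≤ 1) (horth : ∀ i j, i ≠ j → e i * e j = 0) : ∑ i, e i ≤ 1 := by
  set E := ∑ i, e i with hE
  have hE0 : 0 ≤ E := Finset.sum_nonneg fun i _ => he i
  have hEsa : IsSelfAdjoint E := .of_nonneg hE0
  have hEE : E * E = ∑ i, e i * e i := by
    conv_lhs => rw [hE, Finset.mul_sum]
    exact Finset.sum_congr rfl fun i _ => sum_mul_of_orthogonal horth i
  have hle : E * E ≤ E := by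
    rw [hEE]
    refine Finset.sum_le_sum fun i _ => ?_
    have h1 : e i ≤ 1 := (CStarAlgebra.norm_le_one_iff_of_nonneg _ (he i)).mp (he1 i)
    simpa [sq] using CStarAlgebra.pow_antitone (he i) h1 one_le_two
  have hEE0 : 0 ≤ E * E := by simpa [hEsa.star_eq] using star_mul_self_nonneg E
  have hn : ‖E‖ * ‖E‖ ≤ ‖E‖ := by
    have h2 := CStarRing.norm_star_mul_self (x := E)
    rw [hEsa.star_eq] at h2
    rw [← h2]
    exact CStarAlgebra.norm_le_norm_of_nonneg_of_le hEE0 hle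
  rw [← CStarAlgebra.norm_le_one_iff_of_nonneg _ hE0]
  by_contra hcon
  nlinarith

theorem clip_orthogonal {k : ℝ} (hk : 0 < k) {b : ι → A} (hb : ∀ i, 0 ≤ b i)
    (horth : ∀ i j, i ≠ j → b i * b j = 0) :
    ∀ i j, i ≠ j → clip k (b i) * clip k (b j) = 0 := fun i j hij =>
  clip_mul_eq_zero hk (.of_nonneg (hb i)) (mul_clip_eq_zero hk (.of_nonneg (hb j)) (horth i j hij))

/-- For orthogonal positive elements `bᵢ`, the remainder of the truncations `min (bᵢ / k) 1` is
annihilated by the parts of the `bᵢ` above `k`. -/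
theorem one_sub_sum_clip_mul_sub_clip [Fintype ι] {k : ℝ} (hk : 0 < k) {b : ι → A}
    (hb : ∀ i, 0 ≤ b i) (horth : ∀ i j, i ≠ j → b i * b j = 0) (i : ι) :
    (1 - ∑ j, clip k (b j)) * (b i - k • clip k (b i)) = 0 := by
  rw [sub_mul, one_mul, Finset.sum_mul, Finset.sum_eq_single i, clip_mul_sub_clip hk
    (.of_nonneg (hb i)), sub_self]
  · intro j _ hj
    rw [mul_sub, mul_smul_comm, clip_orthogonal hk hb horth j i hj,
      clip_mul_eq_zero hk (.of_nonneg (hb j)) (horth j i hj), smul_zero, sub_zero]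
  · simp

/-- This absorbs the error `η`. The remainder `c` after truncation at `k = 1 - η` annihilates every
`(b i - k)₊`, so `c * (k - ∑ b i) = k c²`. Conjugating `k - ∑ b i ≤ r x r⋆` by `c` gives `k c³ ≤ c r
x r⋆ c`, and `c ≲ c³` finishes. -/
theorem cuntzSubequiv_one_sub_sum_clip [Fintype ι] {η : ℝ} (hη1 : η < 1) {b : ι → A}
    (hb : ∀ i, 0 ≤ b i) (horth : ∀ i j, i ≠ j → b i * b j = 0) {r x : A} (hx : 0 ≤ x)
    (hr : ‖r * x * star r - (1 - ∑ i, b i)‖ ≤ η) :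
    CuntzSubequiv (1 - ∑ i, clip (1 - η) (b i)) x := by
  set k := 1 - η with hk
  have hk0 : 0 < k := by linarith
  set c := 1 - ∑ i, clip k (b i) with hc
  have hc0 : 0 ≤ c := sub_nonneg.mpr <| sum_le_one_of_orthogonal
    (fun i => clip_nonneg hk0 (hb i)) (fun i => norm_clip_le_one hk0 (hb i))
    (clip_orthogonal hk0 hb horth)
  have hcsa : IsSelfAdjoint c := .of_nonneg hc0
  have hsum0 : 0 ≤ ∑ i, b i := Finset.sum_nonneg fun i _ => hb i
  have hle : k • (1 : A) - ∑ i, b i ≤ r * x * star r := by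
    have hsa : IsSelfAdjoint (-(r * x * star r - (1 - ∑ i, b i))) :=
      ((IsSelfAdjoint.of_nonneg (star_right_conjugate_nonneg hx r)).sub
        ((IsSelfAdjoint.one A).sub (.of_nonneg hsum0))).neg
    have h1 := hsa.le_algebraMap_norm_self
    rw [norm_neg, Algebra.algebraMap_eq_smul_one] at h1
    have h2 : ‖r * x * star r - (1 - ∑ i, b i)‖ • (1 : A) ≤ η • 1 :=
      smul_le_smul_of_nonneg_right hr zero_le_one
    have h3 := h1.trans h2
    rw [hk, sub_smul, one_smul]
    rw [neg_sub, sub_le_iff_le_add] at h3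
    rw [sub_sub, sub_le_iff_le_add]
    rw [sub_le_iff_le_add] at h3
    calc (1 : A) ≤ η • 1 + r * x * star r + ∑ i, b i := h3
      _ = _ := by abel
  have hck : c * (k • (1 : A) - ∑ i, b i) = k • (c * c) := by
    have h1 : k • (1 : A) - ∑ i, b i = k • c - ∑ i, (b i - k • clip k (b i)) := by
      rw [hc, Finset.sum_sub_distrib, ← Finset.smul_sum, smul_sub]
      abel
    have h2 : c * ∑ i, (b i - k • clip k (b i)) = 0 := by
      rw [Finset.mul_sum]
      exact Finset.sum_eq_zero fun i _ => one_sub_sum_clip_mul_sub_clip hk0 hb horth i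
    rw [h1, mul_sub, h2, sub_zero, mul_smul_comm]
  have hle' : k • c ^ 3 ≤ c * (r * x * star r) * c := by
    have h1 := hcsa.conjugate_le_conjugate hle
    rwa [hck, smul_mul_assoc, ← sq, ← pow_succ] at h1
  have hc3 : 0 ≤ c ^ 3 := CStarAlgebra.pow_nonneg hc0 3
  have hle2 : c ^ 3 ≤ (k⁻¹.sqrt • (c * r)) * x * star (k⁻¹.sqrt • (c * r)) := by
    have h1 : (k⁻¹.sqrt • (c * r)) * x * star (k⁻¹.sqrt • (c * r))
        = k⁻¹ • (c * (r * x * star r) * c) := by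
      rw [star_smul, star_mul, hcsa.star_eq, smul_mul_assoc, smul_mul_smul_comm, star_trivial,
        Real.mul_self_sqrt (by positivity)]
      simp only [mul_assoc]
    rw [h1, le_inv_smul_iff_of_pos hk0]
    exact hle'
  exact (cuntzSubequiv_pow_three hc0).trans
    ((cuntzSubequiv_of_le hc3 hle2).trans (cuntzSubequiv_conj _ _))

end Orthogonal

/-! ## Lifting orthogonal families -/

section Lift

variable {ι L Q : Type*} [CStarAlgebra L] [PartialOrder L] [StarOrderedRing L]
  [CStarAlgebra Q] [PartialOrder Q] [StarOrderedRing Q]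

theorem exists_nonneg_lift (π : L →⋆ₐ[ℂ] Q) (hπ : Function.Surjective π) {f : Q} (hf : 0 ≤ f) :
    ∃ a : L, 0 ≤ a ∧ π a = f := by
  obtain ⟨y, rfl⟩ := CStarAlgebra.nonneg_iff_eq_star_mul_self.mp hf
  obtain ⟨z, rfl⟩ := hπ y
  exact ⟨star z * z, star_mul_self_nonneg z, by rw [map_mul, map_star]⟩

/-- To adjoin an index `l`, room is made by cutting each old lift down to `(b i - d)₊`, which `w = 1
- ∑ clip d (b i)` annihilates. Since `π (b i) * f l = 0`, the image of `w` fixes `f l`, so `w a w`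
still lifts `f l` for any positive lift `a`. The clause `π (b i) * f j = 0`, required also for `j`
outside `s`, is what carries the induction. The error `ε` is split between the induction hypothesis
and the cut-down. -/
theorem exists_orthogonal_lift_finset [DecidableEq ι] (π : L →⋆ₐ[ℂ] Q)
    (hπ : Function.Surjective π) {f : ι → Q} (hf : ∀ i, 0 ≤ f i)
    (horth : ∀ i j, i ≠ j → f i * f j = 0) (s : Finset ι) : ∀ ε : ℝ, 0 < ε →
    ∃ b : ι → L, (∀ i, 0 ≤ b i) ∧ (∀ i ∈ s, ∀ j ∈ s, i ≠ j → b i * b j = 0) ∧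
      (∀ i ∈ s, ∀ j, i ≠ j → π (b i) * f j = 0) ∧ ∀ i ∈ s, ‖π (b i) - f i‖ ≤ ε := by
  induction s using Finset.induction_on with
  | empty => exact fun ε _ => ⟨0, by simp⟩
  | insert l s hl ih =>
    intro ε hε
    set d := ε / 2 with hd
    have hd0 : 0 < d := by positivity
    obtain ⟨b, hb, hbo, hbf, hbε⟩ := ih d hd0
    have hbsa : ∀ i, IsSelfAdjoint (b i) := fun i => .of_nonneg (hb i)
    have hπb : ∀ i, 0 ≤ π (b i) := fun i => map_nonneg π (hb i)
    obtain ⟨a, ha, hal⟩ := exists_nonneg_lift π hπ (hf l)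
    set w := 1 - ∑ i : s, clip d (b i) with hw
    have hwsa : IsSelfAdjoint w :=
      (IsSelfAdjoint.one L).sub (isSelfAdjoint_sum _ fun i _ => clip_isSelfAdjoint d (b i))
    have hwb : ∀ i ∈ s, w * (b i - d • clip d (b i)) = 0 := fun i hi =>
      one_sub_sum_clip_mul_sub_clip hd0 (b := fun i : s => b i) (fun i => hb i)
        (fun i j hij => hbo i i.2 j j.2 fun h => hij (Subtype.ext h)) ⟨i, hi⟩
    have hbw : ∀ i ∈ s, (b i - d • clip d (b i)) * w = 0 := fun i hi => by
      have h1 := congrArg star (hwb i hi)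
      have h2 : IsSelfAdjoint (b i - d • clip d (b i)) := .of_nonneg (sub_clip_nonneg hd0 (hb i))
      rwa [star_mul, hwsa.star_eq, h2.star_eq, star_zero] at h1
    have hπw : π w * f l = f l := by
      rw [hw, map_sub, map_one, map_sum, sub_mul, one_mul, Finset.sum_mul, Finset.sum_eq_zero,
        sub_zero]
      intro i _
      rw [map_clip π hd0 (hbsa i)]
      exact clip_mul_eq_zero hd0 (.of_nonneg (hπb i))
        (hbf i i.2 l fun h => hl (h ▸ i.2))
    have hπw' : f l * π w = f l := by
      have h1 := congrArg star hπw
      rwa [star_mul, (hwsa.map π).star_eq, (IsSelfAdjoint.of_nonneg (hf l)).star_eq] at h1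
    have hπl : π (w * a * w) = f l := by rw [map_mul, map_mul, hal, hπw, hπw']
    have hπcut : ∀ i, π (b i - d • clip d (b i)) = π (b i) - d • clip d (π (b i)) := fun i => by
      rw [map_sub, ← map_clip π hd0 (hbsa i)]
      congr 1
      exact map_real_smul π (AddMonoidHomClass.continuous_of_bound π 1 fun a => by
        simpa using NonUnitalStarAlgHom.norm_apply_le π a) d _
    have hne : ∀ i ∈ s, i ≠ l := fun i hi h => hl (h ▸ hi)
    refine ⟨fun i => if i = l then w * a * w else b i - d • clip d (b i), ?_, ?_, ?_, ?_⟩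
    · intro i
      dsimp only
      split_ifs
      · exact hwsa.conjugate_nonneg ha
      · exact sub_clip_nonneg hd0 (hb i)
    · intro i hi j hj hij
      dsimp only
      rcases Finset.mem_insert.mp hi with rfl | hi' <;> rcases Finset.mem_insert.mp hj with rfl | hj'
      · exact absurd rfl hij
      · rw [if_pos rfl, if_neg (hne j hj'), mul_assoc, hwb j hj', mul_zero]
      · rw [if_pos rfl, if_neg (hne i hi'), ← mul_assoc, ← mul_assoc, hbw i hi', zero_mul, zero_mul]
      · have h0 := hbo i hi' j hj' hij
        rw [if_neg (hne i hi'), if_neg (hne j hj'), sub_mul, mul_sub, mul_sub, h0, mul_smul_comm,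
          mul_clip_eq_zero hd0 (hbsa j) h0, smul_mul_assoc, clip_mul_eq_zero hd0 (hbsa i) h0,
          smul_mul_smul_comm, clip_mul_eq_zero hd0 (hbsa i) (mul_clip_eq_zero hd0 (hbsa j) h0)]
        simp
    · intro i hi j hij
      dsimp only
      rcases Finset.mem_insert.mp hi with rfl | hi
      · rw [if_pos rfl, hπl, horth i j hij]
      · rw [if_neg (hne i hi), hπcut, sub_mul, smul_mul_assoc, hbf i hi j hij,
          clip_mul_eq_zero hd0 (.of_nonneg (hπb i)) (hbf i hi j hij), smul_zero, sub_zero]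
    · intro i hi
      dsimp only
      rcases Finset.mem_insert.mp hi with rfl | hi
      · rw [if_pos rfl, hπl, sub_self, norm_zero]
        exact hε.le
      · rw [if_neg (hne i hi), hπcut, sub_right_comm]
        refine (norm_sub_le _ _).trans ?_
        linarith [hbε i hi, norm_smul_clip_le hd0 (hπb i)]

/-- Orthogonal families of positive elements in a quotient lift, up to an arbitrarily small
perturbation, to orthogonal families of positive elements. -/
theorem exists_orthogonal_lift [Fintype ι] (π : L →⋆ₐ[ℂ] Q) (hπ : Function.Surjective π)
    {f : ι → Q} (hf : ∀ i, 0 ≤ f i) (horth : ∀ i j, i ≠ j → f i * f j = 0) {ε : ℝ} (hε : 0 < ε) :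
    ∃ b : ι → L, (∀ i, 0 ≤ b i) ∧ (∀ i j, i ≠ j → b i * b j = 0) ∧ ∀ i, ‖π (b i) - f i‖ ≤ ε := by
  classical
  obtain ⟨b, h1, h2, -, h3⟩ := exists_orthogonal_lift_finset π hπ hf horth Finset.univ ε hε
  exact ⟨b, h1, fun i j => h2 i (Finset.mem_univ i) j (Finset.mem_univ j),
    fun i => h3 i (Finset.mem_univ i)⟩

end Lift

/-! ## Positive elements and commutation -/

section Commutation

variable {ι B : Type*} [CStarAlgebra B] [PartialOrder B] [StarOrderedRing B]

/-- With `b = y⋆ y`, the bound gives `(z y⋆)(z y⋆)⋆ = z b z⋆ ≤ t z f z⋆ = 0`. -/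
theorem mul_eq_zero_of_le_smul {z b f : B} {t : ℝ} (hb : 0 ≤ b) (hbf : b ≤ t • f)
    (hz : z * f = 0) : z * b = 0 := by
  obtain ⟨y, rfl⟩ := CStarAlgebra.nonneg_iff_eq_star_mul_self.mp hb
  have h1 : z * (star y * y) * star z ≤ 0 := by
    refine (star_right_conjugate_le_conjugate hbf z).trans_eq ?_
    rw [mul_smul_comm, hz, smul_zero, zero_mul]
  have h2 : z * star y * star (z * star y) = 0 := by
    rw [star_mul, star_star, ← le_antisymm h1 (star_right_conjugate_nonneg hb z)]
    simp only [mul_assoc]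
  rw [← mul_assoc, (CStarRing.mul_star_self_eq_zero_iff _).mp h2, zero_mul]

/-- If `∑ bᵢ = (∑ fᵢ) a = a (∑ fᵢ)` for orthogonal families of positive elements with `bᵢ`
dominated by `fᵢ`, then `a` commutes with every `fᵢ`. -/
theorem commute_of_sum_eq [Fintype ι] {f b : ι → B} {a : B} {t : ℝ} (ha : IsSelfAdjoint a)
    (hf : ∀ i, 0 ≤ f i) (hb : ∀ i, 0 ≤ b i) (hff : ∀ i j, i ≠ j → f i * f j = 0)
    (hbf : ∀ i j, i ≠ j → b i * f j = 0) (hle : ∀ i, b i ≤ t • f i)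
    (hsum : ∑ i, b i = a * ∑ i, f i) (i : ι) : Commute a (f i) := by
  have hfsa : IsSelfAdjoint (f i) := .of_nonneg (hf i)
  have hbsa : IsSelfAdjoint (b i) := .of_nonneg (hb i)
  -- Multiplying the sum identity by `f i` on the right leaves `z * f i = 0`, and domination then
  -- gives `z * b i = 0`. So `z z⋆ = z * b i - z * f i * a = 0`, that is `b i = a * f i`; taking
  -- adjoints gives commutation.
  set z := b i - a * f i with hz
  have hzf : z * f i = 0 := by
    have h1 : (∑ j, b j) * f i = b i * f i := by
      rw [Finset.sum_mul]
      exact Finset.sum_eq_single i (fun j _ hj => hbf j i hj) (by simp)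
    rw [hz, sub_mul, ← h1, hsum, mul_assoc, sum_mul_of_orthogonal hff, mul_assoc, sub_self]
  have hz0 : z = 0 := by
    rw [← CStarRing.mul_star_self_eq_zero_iff]
    have h2 : star z = b i - f i * a := by
      rw [hz, star_sub, star_mul, hbsa.star_eq, hfsa.star_eq, ha.star_eq]
    rw [h2, mul_sub, ← mul_assoc, hzf, mul_eq_zero_of_le_smul (hb i) (hle i) hzf, zero_mul,
      sub_zero]
  have h3 : b i = a * f i := sub_eq_zero.mp hz0
  have h4 := congrArg star h3
  rw [hbsa.star_eq, star_mul, hfsa.star_eq, ha.star_eq, h3] at h4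
  exact h4

end Commutation

/-! ## Bounded sequences and the ultrapower -/

section UltrapowerLemmas

variable {A : Type*} [CStarAlgebra A] {ω : Ultrafilter ℕ}

variable (A ω) in
/-- The quotient map `ℓ^∞(ℕ, A) → A_ω` as a `*`-homomorphism. -/
noncomputable def Ultrapower.mkStar : (ℕ →ᵇ A) →⋆ₐ[ℂ] Ultrapower A ω where
  __ := Ultrapower.mk A ω
  map_star' _ := rfl

theorem Ultrapower.action_mk {G : Type*} [Group G] (α : G →* (A ≃⋆ₐ[ℂ] A)) (g : G)
    (a : ℕ →ᵇ A) : Ultrapower.action ω α g (Ultrapower.mk A ω a)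
      = Ultrapower.mk A ω (Ultrapower.mapSeq (α g : A →⋆ₐ[ℂ] A) a) := rfl

theorem Ultrapower.const_apply (a : A) :
    Ultrapower.const A ω a = Ultrapower.mk A ω (BoundedContinuousFunction.const ℕ a) := rfl

theorem Ultrapower.norm_const (a : A) : ‖Ultrapower.const A ω a‖ = ‖a‖ :=
  Ultrapower.norm_mk_eq_of_tendsto tendsto_const_nhds

theorem Ultrapower.exists_lift_nonneg [PartialOrder A] [StarOrderedRing A] {x : Ultrapower A ω}
    (hx : 0 ≤ x) : ∃ y : ℕ →ᵇ A, (∀ n, 0 ≤ y n) ∧ Ultrapower.mk A ω y = x := by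
  obtain ⟨z, rfl⟩ := CStarAlgebra.nonneg_iff_eq_star_mul_self.mp hx
  obtain ⟨c, rfl⟩ := Ultrapower.mk_surjective z
  exact ⟨star c * c, fun n => star_mul_self_nonneg (c n), by rw [Ultrapower.star_mk, map_mul]⟩

theorem Ultrapower.mk_nonneg [PartialOrder A] [StarOrderedRing A] {y : ℕ →ᵇ A}
    (hy : ∀ n, 0 ≤ y n) : 0 ≤ Ultrapower.mk A ω y := by
  have hb : ∀ n, ‖cfc Real.sqrt (y n)‖ ≤ √‖y‖ := fun n => by
    refine norm_cfc_le (Real.sqrt_nonneg _) fun t ht => ?_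
    rcases subsingleton_or_nontrivial A with hA | hA
    · exact absurd ht (by simp [spectrum.of_subsingleton])
    · rw [Real.norm_of_nonneg (Real.sqrt_nonneg _)]
      exact Real.sqrt_le_sqrt (((le_abs_self t).trans (spectrum.norm_le_norm_of_mem ht)).trans
        (y.norm_coe_le_norm n))
  let s : ℕ →ᵇ A := BoundedContinuousFunction.ofNormedAddCommGroup
    (fun n => cfc Real.sqrt (y n)) continuous_of_discreteTopology _ hb
  have hs : y = star s * s := by
    ext n
    change y n = star (cfc Real.sqrt (y n)) * cfc Real.sqrt (y n)
    rw [(cfc_predicate Real.sqrt (y n) : IsSelfAdjoint _).star_eq, ← cfc_mul Real.sqrt Real.sqrt]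
    conv_lhs => rw [← cfc_id ℝ (y n)]
    exact cfc_congr fun t ht =>
      (Real.mul_self_sqrt (spectrum_nonneg_of_nonneg (hy n) ht)).symm
  rw [hs, map_mul, ← Ultrapower.star_mk]
  exact star_mul_self_nonneg _

theorem exists_orthogonal_lift_seq [PartialOrder A] [StarOrderedRing A] {ι : Type*} [Fintype ι]
    {f : ι → Ultrapower A ω} (hf : ∀ i, 0 ≤ f i) (horth : ∀ i j, i ≠ j → f i * f j = 0) {ε : ℝ}
    (hε : 0 < ε) : ∃ b : ι → ℕ →ᵇ A, (∀ i n, 0 ≤ b i n) ∧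
      (∀ i j, i ≠ j → ∀ n, b i n * b j n = 0) ∧ ∀ i, ‖Ultrapower.mk A ω (b i) - f i‖ ≤ ε := by
  let _ : PartialOrder (ℕ →ᵇ A) := CStarAlgebra.spectralOrder _
  have _ : StarOrderedRing (ℕ →ᵇ A) := CStarAlgebra.spectralOrderedRing _
  obtain ⟨b, h1, h2, h3⟩ := exists_orthogonal_lift (Ultrapower.mkStar A ω)
    Ultrapower.mk_surjective hf horth hε
  refine ⟨b, fun i n => ?_, fun i j hij n => congrArg (fun c : ℕ →ᵇ A => c n) (h2 i j hij), h3⟩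
  obtain ⟨c, hc⟩ := CStarAlgebra.nonneg_iff_eq_star_mul_self.mp (h1 i)
  rw [hc]
  exact star_mul_self_nonneg (c n)

end UltrapowerLemmas

/-! ## Functions supported at a point -/

section SingleMap

variable {A G : Type*} [CStarAlgebra A] [TopologicalSpace G] [DiscreteTopology G]

open scoped Classical in
/-- The function `G → A` with value `a` at `h` and `0` elsewhere. -/
noncomputable def singleMap (h : G) (a : A) : C(G, A) :=
  ⟨Pi.single h a, continuous_of_discreteTopology⟩

open scoped Classical in
theorem singleMap_apply (h : G) (a : A) (k : G) :
    singleMap h a k = if k = h then a else 0 := Pi.single_apply h a k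

theorem singleMap_mono [PartialOrder A] [StarOrderedRing A] (h : G) {a b : A} (hab : a ≤ b) : singleMap h a ≤ singleMap h b := by
  intro k
  change singleMap h a k ≤ singleMap h b k
  rw [singleMap_apply, singleMap_apply]
  split_ifs
  exacts [hab, le_rfl]

theorem singleMap_zero (h : G) : singleMap h (0 : A) = 0 := by
  ext k
  simp [singleMap_apply]

theorem singleMap_nonneg [PartialOrder A] [StarOrderedRing A] (h : G) {a : A} (ha : 0 ≤ a) : 0 ≤ singleMap h a :=
  singleMap_zero (A := A) h ▸ singleMap_mono h ha

theorem singleMap_smul (h : G) (c : ℂ) (a : A) : singleMap h (c • a) = c • singleMap h a := by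
  ext k
  simp [singleMap_apply]

theorem singleMap_mul_singleMap {h k : G} (hhk : h ≠ k) (a b : A) :
    singleMap h a * singleMap k b = 0 := by
  ext l
  simp only [ContinuousMap.mul_apply, singleMap_apply, ContinuousMap.zero_apply]
  split_ifs with h1 h2
  · exact absurd (h1.symm.trans h2) hhk
  all_goals simp

theorem shiftTensor_singleMap [Group G] (α : G →* (A ≃⋆ₐ[ℂ] A)) (g h : G) (a : A) :
    shiftTensor α g (singleMap h a) = singleMap (g * h) (α g a) := by
  ext k
  change α g (singleMap h a (g⁻¹ * k)) = _
  rw [singleMap_apply, singleMap_apply]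
  by_cases h1 : k = g * h
  · rw [if_pos h1, if_pos (inv_mul_eq_iff_eq_mul.mpr h1)]
  · rw [if_neg h1, if_neg fun h2 => h1 (inv_mul_eq_iff_eq_mul.mp h2), map_zero]

theorem sum_singleMap [Fintype G] (a : A) : ∑ h : G, singleMap h a = oneTensor G a := by
  ext k
  change _ = (1 : ℂ) • a
  rw [ContinuousMap.sum_apply, one_smul, Finset.sum_eq_single k (fun h _ hh => ?_) (by simp)]
  · simp [singleMap_apply]
  · rw [singleMap_apply, if_neg hh.symm]

end SingleMap

/-! ## From sequential splitting to the tracial Rokhlin property -/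

section Backward

variable {A G : Type*} [CStarAlgebra A] [PartialOrder A] [StarOrderedRing A] {ω : Ultrafilter ℕ}
  [Group G] [Fintype G]

/-- An equivariant orthogonal partition in `A_ω ∩ A'` with remainder Cuntz below `x` can be
perturbed to elements of `A` as in the generalized tracial Rokhlin property. -/
theorem exists_rokhlin_of_ultrapower [Nontrivial A] (α : G →* (A ≃⋆ₐ[ℂ] A))
    {f : G → Ultrapower A ω} (hf : ∀ h, 0 ≤ f h) (hf1 : ∀ h, ‖f h‖ = 1)
    (horth : ∀ h k, h ≠ k → f h * f k = 0)
    (heq : ∀ g h, Ultrapower.action ω α g (f h) = f (g * h))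
    (hcen : ∀ h, f h ∈ Ultrapower.central A ω) {x : A} (hx : 0 ≤ x)
    (hcuntz : CuntzSubequiv (1 - ∑ h, f h) (Ultrapower.const A ω x))
    (F : Finset A) {ε : ℝ} (hε : 0 < ε) :
    ∃ e : G → A,
      (∀ g, 0 ≤ e g ∧ ‖e g‖ = 1) ∧
      (∀ g h, g ≠ h → e g * e h = 0) ∧
      (∀ g h, ‖α g (e h) - e (g * h)‖ ≤ ε) ∧
      (∀ g, ∀ a ∈ F, ‖e g * a - a * e g‖ ≤ ε) ∧
      CuntzSubequiv (1 - ∑ g, e g) x := by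
  set M := ∑ a ∈ F, ‖a‖ with hM
  have hM0 : 0 ≤ M := Finset.sum_nonneg fun _ _ => norm_nonneg _
  have hFM : ∀ a ∈ F, ‖a‖ ≤ M := fun a ha =>
    Finset.single_le_sum (f := fun a : A => ‖a‖) (fun _ _ => norm_nonneg _) ha
  set N : ℝ := (Fintype.card G : ℝ) with hN
  have hN0 : 0 ≤ N := Nat.cast_nonneg _
  -- After truncation the equivariance error is at most `3 * η` and the commutator error at most `(4
  -- * M + 1) * η`; both are below `5 * (M + 1) * η`. The bound `1 / 2` keeps the truncation level
  -- `1 - η` positive.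
  set η := min (1 / 2) (ε / (5 * (M + 1))) with hη
  have hη0 : 0 < η := by positivity
  have hη1 : η ≤ 1 / 2 := min_le_left _ _
  have hηε : 5 * (M + 1) * η ≤ ε := by
    have := min_le_right (1 / 2) (ε / (5 * (M + 1)))
    rw [← hη, le_div_iff₀ (by positivity)] at this
    linarith
  -- The remainder collects one error `δ` from `R` and one from each of the `N` lifts; `N + 3` makes
  -- this total, and the `2 * δ` in the equivariance estimate, strictly less than `η`.
  set δ := η / (N + 3) with hδ
  have hδ0 : 0 < δ := by positivity
  have hδη : (N + 3) * δ = η := by rw [hδ]; field_simp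
  have hNδ : 0 ≤ N * δ := by positivity
  obtain ⟨b, hb, hbo, hbf⟩ := exists_orthogonal_lift_seq hf horth hδ0
  obtain ⟨R, hR⟩ := cuntzSubequiv_iff.mp hcuntz δ hδ0
  obtain ⟨r, rfl⟩ := Ultrapower.mk_surjective R
  have E1 : ∀ᶠ n in (ω : Filter ℕ), ∀ h, ‖b h n‖ < 1 + η := by
    rw [eventually_all]
    intro h
    refine Ultrapower.eventually_norm_lt ?_
    have := norm_add_le (Ultrapower.mk A ω (b h) - f h) (f h)
    rw [sub_add_cancel, hf1] at this
    linarith [hbf h]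
  have E2 : ∀ᶠ n in (ω : Filter ℕ), ∀ h, 1 - η < ‖b h n‖ := by
    rw [eventually_all]
    intro h
    refine (tendsto_order.mp (Ultrapower.tendsto_norm (b h))).1 _ ?_
    have := norm_sub_le (Ultrapower.mk A ω (b h)) (Ultrapower.mk A ω (b h) - f h)
    rw [sub_sub_cancel, hf1] at this
    linarith [hbf h]
  have E3 : ∀ᶠ n in (ω : Filter ℕ), ∀ g h, ‖α g (b h n) - b (g * h) n‖ < η := by
    simp_rw [eventually_all]
    intro g h
    refine Ultrapower.eventually_norm_lt
      (a := Ultrapower.mapSeq (α g : A →⋆ₐ[ℂ] A) (b h) - b (g * h)) ?_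
    rw [map_sub, ← Ultrapower.action_mk]
    have e : Ultrapower.action ω α g (Ultrapower.mk A ω (b h)) - Ultrapower.mk A ω (b (g * h))
        = Ultrapower.action ω α g (Ultrapower.mk A ω (b h) - f h)
          - (Ultrapower.mk A ω (b (g * h)) - f (g * h)) := by
      rw [map_sub, heq]; abel
    have h1 := norm_sub_le (Ultrapower.action ω α g (Ultrapower.mk A ω (b h) - f h))
      (Ultrapower.mk A ω (b (g * h)) - f (g * h))
    have h2 := NonUnitalStarAlgHom.norm_apply_le (Ultrapower.action ω α g)
      (Ultrapower.mk A ω (b h) - f h)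
    rw [e]
    linarith [hbf h, hbf (g * h)]
  have E4 : ∀ᶠ n in (ω : Filter ℕ), ∀ h, ∀ a ∈ F, ‖b h n * a - a * b h n‖ < 2 * η * M + η := by
    rw [eventually_all]
    intro h
    rw [Filter.eventually_all_finset]
    intro a ha
    refine Ultrapower.eventually_norm_lt
      (a := b h * BoundedContinuousFunction.const ℕ a
        - BoundedContinuousFunction.const ℕ a * b h) ?_
    rw [map_sub, map_mul, map_mul, ← Ultrapower.const_apply]
    set c := Ultrapower.const A ω a with hc
    have hca : ‖c‖ ≤ M := by rw [hc, Ultrapower.norm_const]; exact hFM a ha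
    have hcomm : c * f h = f h * c := Ultrapower.mem_central.mp (hcen h) a
    set u := Ultrapower.mk A ω (b h) - f h with hu
    have e : Ultrapower.mk A ω (b h) * c - c * Ultrapower.mk A ω (b h) = u * c - c * u := by
      rw [hu, sub_mul, mul_sub, hcomm]; abel
    have huη : ‖u‖ ≤ η := by linarith [hbf h]
    have h1 : ‖u * c‖ ≤ η * M := (norm_mul_le _ _).trans (by gcongr)
    have h2 : ‖c * u‖ ≤ M * η := (norm_mul_le _ _).trans (by gcongr)
    rw [e]
    linarith [norm_sub_le (u * c) (c * u)]
  have E5 : ∀ᶠ n in (ω : Filter ℕ), ‖r n * x * star (r n) - (1 - ∑ h, b h n)‖ < η := by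
    have h0 : ‖Ultrapower.mk A ω (r * BoundedContinuousFunction.const ℕ x * star r
        - (1 - ∑ h, b h))‖ < η := by
      rw [map_sub, map_mul, map_mul, map_sub, map_one, map_sum, ← Ultrapower.const_apply,
        ← Ultrapower.star_mk]
      have e : Ultrapower.mk A ω r * Ultrapower.const A ω x * star (Ultrapower.mk A ω r)
          - (1 - ∑ h, Ultrapower.mk A ω (b h))
          = (Ultrapower.mk A ω r * Ultrapower.const A ω x * star (Ultrapower.mk A ω r)
            - (1 - ∑ h, f h)) + ∑ h, (Ultrapower.mk A ω (b h) - f h) := by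
        rw [Finset.sum_sub_distrib]; abel
      have h1 : ‖∑ h, (Ultrapower.mk A ω (b h) - f h)‖ ≤ N * δ := by
        refine (norm_sum_le_of_le _ fun h _ => hbf h).trans_eq ?_
        simp [hN]
      rw [e]
      refine (norm_add_le _ _).trans_lt ?_
      linarith
    filter_upwards [Ultrapower.eventually_norm_lt h0] with n hn
    simpa [BoundedContinuousFunction.sum_apply] using hn
  obtain ⟨n, h1, h2, h3, h4, h5⟩ :=
    (E1.and (E2.and (E3.and (E4.and E5)))).exists
  -- At level `1 - η` truncation moves each `b h n` by at most `η`, and since `‖b h n‖ > 1 - η` the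
  -- result has norm exactly one.
  have hk0 : 0 < 1 - η := by linarith
  have hclip : ∀ h, ‖b h n - clip (1 - η) (b h n)‖ ≤ η := fun h =>
    norm_sub_clip_le hk0 (hb h n) le_rfl (by linarith) (h1 h).le
  refine ⟨fun h => clip (1 - η) (b h n), fun h => ⟨clip_nonneg hk0 (hb h n),
    norm_clip_eq_one hk0 (hb h n) (h2 h).le⟩,
    clip_orthogonal hk0 (fun h => hb h n) (fun h k hhk => hbo h k hhk n), fun g h => ?_,
    fun h a ha => ?_,
    cuntzSubequiv_one_sub_sum_clip (by linarith) (fun h => hb h n)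
      (fun h k hhk => hbo h k hhk n) hx h5.le⟩
  · have e : α g (clip (1 - η) (b h n)) - clip (1 - η) (b (g * h) n)
        = (α g (b h n) - b (g * h) n) - α g (b h n - clip (1 - η) (b h n))
          + (b (g * h) n - clip (1 - η) (b (g * h) n)) := by
      rw [map_sub]; abel
    have i1 := NonUnitalStarAlgHom.norm_apply_le (α g) (b h n - clip (1 - η) (b h n))
    have i2 : 3 * η ≤ ε := by nlinarith
    dsimp only
    rw [e]
    refine (norm_add_le _ _).trans ?_
    linarith [norm_sub_le (α g (b h n) - b (g * h) n) (α g (b h n - clip (1 - η) (b h n))),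
      hclip h, hclip (g * h), h3 g h]
  · dsimp only
    set u := b h n - clip (1 - η) (b h n) with hu
    have e : clip (1 - η) (b h n) * a - a * clip (1 - η) (b h n)
        = (b h n * a - a * b h n) - (u * a - a * u) := by
      rw [hu, sub_mul, mul_sub]; abel
    have i1 : ‖u * a‖ ≤ η * M := (norm_mul_le _ _).trans
      (mul_le_mul (hclip h) (hFM a ha) (norm_nonneg _) hη0.le)
    have i2 : ‖a * u‖ ≤ M * η := (norm_mul_le _ _).trans
      (mul_le_mul (hFM a ha) (hclip h) (norm_nonneg _) hM0)
    have i3 : 0 ≤ η * M := by positivity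
    rw [e]
    refine (norm_sub_le _ _).trans ?_
    linarith [norm_sub_le (u * a) (a * u), h4 h a ha]

variable [TopologicalSpace G] [DiscreteTopology G]

theorem hasGeneralizedTracialRokhlinProperty_of_split (α : G →* (A ≃⋆ₐ[ℂ] A))
    (hsplit : (equivariantOneTensor α).IsTraciallySequentiallySplitByOrderZero ω) :
    HasGeneralizedTracialRokhlinProperty α := by
  intro F ε x hε hx hx0
  have _ : Nontrivial A := ⟨x, 0, hx0⟩
  have hcx : 0 ≤ Ultrapower.const A ω x := map_nonneg (Ultrapower.const A ω) hx
  obtain ⟨ψ, hψ0, hψeq, g, -, hg, hgne, hψg, hcuntz⟩ := hsplit (Ultrapower.const A ω x) hcx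
    (by rw [← norm_pos_iff, Ultrapower.norm_const]; exact norm_pos_iff.mpr hx0)
  have hmono : ∀ {u v : C(G, A)}, u ≤ v → ψ u ≤ ψ v := fun huv => OrderHomClass.mono ψ huv
  have hψpos : ∀ {u : C(G, A)}, 0 ≤ u → 0 ≤ ψ u := fun hu => by
    simpa using hmono hu
  set f : G → Ultrapower A ω := fun h => ψ (singleMap h 1) with hfdef
  have hf : ∀ h, 0 ≤ f h := fun h => hψpos (singleMap_nonneg h zero_le_one)
  have horth' : ∀ {a b : A}, 0 ≤ a → 0 ≤ b → ∀ h k : G, h ≠ k →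
      ψ (singleMap h a) * ψ (singleMap k b) = 0 := fun ha hb h k hhk =>
    (hψ0 _ _ (singleMap_nonneg h ha) (singleMap_nonneg k hb) (singleMap_mul_singleMap hhk _ _)
      (singleMap_mul_singleMap hhk.symm _ _)).1
  have horth : ∀ h k, h ≠ k → f h * f k = 0 := horth' zero_le_one zero_le_one
  have hsum : ∀ a : A, ∑ h, ψ (singleMap h a) = Ultrapower.const A ω a * g := fun a => by
    rw [← map_sum, sum_singleMap]
    exact (hψg a).2
  have hsumf : ∑ h, f h = g := by rw [hfdef, hsum 1, map_one, one_mul]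
  have heq : ∀ k h, Ultrapower.action ω α k (f h) = f (k * h) := fun k h => by
    rw [hfdef]
    dsimp only
    rw [← hψeq, shiftTensor_singleMap, map_one]
  have hcen : ∀ h, f h ∈ Ultrapower.central A ω := by
    intro h
    rw [Ultrapower.mem_central]
    intro a
    -- Positive elements span `A`, and for `a ≥ 0` the elements `ψ (δ_k ⊗ a)` are dominated by `‖a‖
    -- • f k`, orthogonal to the other `f h`, and sum to `a * g`.
    have ha : a ∈ Submodule.span ℂ {a : A | 0 ≤ a} := by
      rw [CStarAlgebra.span_nonneg]; trivial
    induction ha using Submodule.span_induction with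
    | zero => simp
    | add a b _ _ iha ihb => rw [map_add, add_mul, mul_add, iha, ihb]
    | smul c a _ iha => rw [map_smul, smul_mul_assoc, mul_smul_comm, iha]
    | mem a ha =>
      have ha : 0 ≤ a := ha
      have hle : ∀ k, ψ (singleMap k a) ≤ ‖a‖ • f k := fun k => by
        have h1 : a ≤ (‖a‖ : ℂ) • (1 : A) := by
          have := (IsSelfAdjoint.of_nonneg ha).le_algebraMap_norm_self
          rwa [Algebra.algebraMap_eq_smul_one, ← Complex.coe_smul] at this
        have h2 := hmono (singleMap_mono k h1)
        rwa [singleMap_smul, map_smul, Complex.coe_smul] at h2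
      exact commute_of_sum_eq ((IsSelfAdjoint.of_nonneg ha).map (Ultrapower.const A ω)) hf
        (fun k => hψpos (singleMap_nonneg k ha)) horth (horth' ha zero_le_one) hle
        (by rw [hsum, hsumf]) h
  -- The action permutes the `f h` transitively, so they share the norm `c`; it is positive because
  -- `g ≠ 0` and at most `1` because `f 1 ≤ g ≤ 1`.
  set c := ‖f 1‖ with hc
  have hnorm : ∀ h, ‖f h‖ = c := fun h => by
    have h1 := heq h 1
    rw [mul_one] at h1
    rw [← h1, hc]
    exact StarAlgEquiv.norm_map (Ultrapower.action ω α h) (f 1)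
  have hc0 : 0 < c := by
    refine lt_of_le_of_ne (norm_nonneg _) fun h0 => hgne ?_
    rw [← hsumf]
    exact Finset.sum_eq_zero fun h _ => norm_eq_zero.mp ((hnorm h).trans h0.symm)
  have hg1 : g ≤ 1 := sub_nonneg.mp (hcuntz.nonneg hcx)
  have hc1 : c ≤ 1 := (CStarAlgebra.norm_le_norm_of_nonneg_of_le (hf 1)
    (Finset.single_le_sum (fun h _ => hf h) (Finset.mem_univ 1))).trans
      (by rw [hsumf]; exact (CStarAlgebra.norm_le_one_iff_of_nonneg g hg).mpr hg1)
  -- Scaling up to norm one only shrinks the remainder: `0 ≤ 1 - c⁻¹ • g ≤ 1 - g`, the left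
  -- inequality by orthogonality.
  set f' : G → Ultrapower A ω := fun h => c⁻¹ • f h with hf'
  have hf'0 : ∀ h, 0 ≤ f' h := fun h => smul_nonneg (inv_nonneg.mpr hc0.le) (hf h)
  have hf'1 : ∀ h, ‖f' h‖ = 1 := fun h => by
    rw [hf', norm_smul, norm_inv, hnorm, Real.norm_of_nonneg hc0.le, inv_mul_cancel₀ hc0.ne']
  have hf'o : ∀ h k, h ≠ k → f' h * f' k = 0 := fun h k hhk => by
    rw [hf', smul_mul_smul_comm, horth h k hhk, smul_zero]
  refine exists_rokhlin_of_ultrapower α hf'0 hf'1 hf'o (fun k h => ?_) (fun h => ?_) hx ?_ F hε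
  · rw [hf']
    dsimp only
    rw [← heq k h, ← Complex.coe_smul, ← Complex.coe_smul, map_smul]
  · rw [Ultrapower.mem_central]
    intro a
    rw [hf', mul_smul_comm, smul_mul_assoc, Ultrapower.mem_central.mp (hcen h) a]
  · refine (cuntzSubequiv_of_le (sub_nonneg.mpr (sum_le_one_of_orthogonal hf'0
      (fun h => (hf'1 h).le) hf'o)) ?_).trans hcuntz
    rw [hf', ← Finset.smul_sum, hsumf]
    refine sub_le_sub_left ?_ 1
    have h1 : (1 : ℝ) • g ≤ c⁻¹ • g :=
      smul_le_smul_of_nonneg_right ((one_le_inv₀ hc0).mpr hc1) hg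
    rwa [one_smul] at h1

end Backward

/-! ## From the tracial Rokhlin property to sequential splitting -/

section WeightedEval

theorem exists_eq_star_mul_self_of_nonneg {B : Type*} [NonUnitalCStarAlgebra B] [PartialOrder B]
    [StarOrderedRing B] {a : B} (ha : 0 ≤ a) : ∃ b, a = star b * b :=
  CStarAlgebra.nonneg_iff_eq_star_mul_self.mp ha

variable {G A B : Type*} [Fintype G] [TopologicalSpace G] [CStarAlgebra A] [CStarAlgebra B]

/-- This is the complete positivity of `weightedEval`: with `s h = √(f h)` commuting with the range
of `φ`, the image of `N⋆ N` is a sum of squares `V h⋆ V h`, where `V h` has entries `φ (N i j h) * s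
h`. -/
theorem cstarMatrix_map_sum_eval (φ : A →⋆ₐ[ℂ] B) {f s : G → B}
    (hs : ∀ h, IsSelfAdjoint (s h)) (hss : ∀ h, s h * s h = f h)
    (hcomm : ∀ h a, Commute (φ a) (s h)) (n : ℕ) (N : CStarMatrix (Fin n) (Fin n) C(G, A)) :
    (star N * N).map (fun F : C(G, A) => ∑ h, φ (F h) * f h)
      = ∑ h, star (N.map fun F : C(G, A) => φ (F h) * s h)
          * N.map fun F : C(G, A) => φ (F h) * s h := by
  ext i j
  have hsum : ∀ V : G → CStarMatrix (Fin n) (Fin n) B, (∑ h, V h) i j = ∑ h, V h i j :=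
    fun V => map_sum (AddMonoidHom.mk' (fun W : CStarMatrix (Fin n) (Fin n) B => W i j)
      fun _ _ => rfl) V Finset.univ
  rw [hsum]
  simp only [CStarMatrix.map_apply, CStarMatrix.mul_apply, CStarMatrix.star_apply]
  refine Finset.sum_congr rfl fun h _ => ?_
  rw [ContinuousMap.sum_apply, map_sum, Finset.sum_mul]
  refine Finset.sum_congr rfl fun l _ => ?_
  rw [ContinuousMap.mul_apply, map_mul, star_mul, (hs h).star_eq, ContinuousMap.star_apply,
    map_star, ← map_star, ← hss, (hcomm h (star (N l i h))).symm.eq]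
  simp only [mul_assoc]
  rw [← mul_assoc (s h) (φ (N l j h)), (hcomm h (N l j h)).symm.eq, mul_assoc]

variable [CompactSpace G] [PartialOrder A] [StarOrderedRing A] [PartialOrder B] [StarOrderedRing B]

/-- The completely positive map `F ↦ ∑ h, φ (F h) * f h` attached to a `*`-homomorphism `φ` and
positive elements `f h` commuting with the range of `φ`. -/
noncomputable def weightedEval (φ : A →⋆ₐ[ℂ] B) (f : G → B) (hf : ∀ h, 0 ≤ f h)
    (hcomm : ∀ h a, Commute (φ a) (f h)) : C(G, A) →CP B where
  toFun F := ∑ h, φ (F h) * f h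
  map_add' F F' := by
    rw [← Finset.sum_add_distrib]
    exact Finset.sum_congr rfl fun h _ => by rw [ContinuousMap.add_apply, map_add, add_mul]
  map_smul' c F := by
    rw [RingHom.id_apply, Finset.smul_sum]
    exact Finset.sum_congr rfl fun h _ => by
      rw [ContinuousMap.smul_apply, map_smul, smul_mul_assoc]
  map_cstarMatrix_nonneg' n M hM := by
    obtain ⟨N, rfl⟩ := exists_eq_star_mul_self_of_nonneg hM
    refine (Finset.sum_nonneg fun h _ => star_mul_self_nonneg _).trans_eq
      (cstarMatrix_map_sum_eval φ (f := f) (s := fun h => cfc Real.sqrt (f h))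
        (fun h => cfc_predicate _ _) (fun h => ?_)
        (fun h a => ((hcomm h a).symm.cfc_real _).symm) n N).symm
    rw [← cfc_mul Real.sqrt Real.sqrt (f h)]
    conv_rhs => rw [← cfc_id ℝ (f h)]
    exact cfc_congr fun t ht => Real.mul_self_sqrt (spectrum_nonneg_of_nonneg (hf h) ht)

theorem weightedEval_apply (φ : A →⋆ₐ[ℂ] B) (f : G → B) (hf : ∀ h, 0 ≤ f h)
    (hcomm : ∀ h a, Commute (φ a) (f h)) (F : C(G, A)) :
    weightedEval φ f hf hcomm F = ∑ h, φ (F h) * f h := rfl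

theorem weightedEval_mul_eq_zero (φ : A →⋆ₐ[ℂ] B) {f : G → B} (hf : ∀ h, 0 ≤ f h)
    (hcomm : ∀ h a, Commute (φ a) (f h)) (horth : ∀ h k, h ≠ k → f h * f k = 0)
    {F F' : C(G, A)} (hFF' : F * F' = 0) :
    weightedEval φ f hf hcomm F * weightedEval φ f hf hcomm F' = 0 := by
  rw [weightedEval_apply, weightedEval_apply, Finset.sum_mul]
  refine Finset.sum_eq_zero fun h _ => ?_
  rw [Finset.mul_sum]
  refine Finset.sum_eq_zero fun k _ => ?_
  -- The terms with `h ≠ k` vanish by orthogonality of the `f h`, the diagonal ones because `F * F'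
  -- = 0` pointwise.
  have e : φ (F h) * f h * (φ (F' k) * f k) = φ (F h) * φ (F' k) * (f h * f k) := by
    rw [mul_assoc, ← mul_assoc (f h), ← (hcomm h (F' k)).eq]
    simp only [mul_assoc]
  rw [e]
  by_cases hhk : h = k
  · subst hhk
    rw [← map_mul, ← ContinuousMap.mul_apply, hFF', ContinuousMap.zero_apply, map_zero, zero_mul]
  · rw [horth h k hhk, mul_zero]

end WeightedEval

section Forward

variable {A G : Type*} [CStarAlgebra A] [PartialOrder A] [StarOrderedRing A] {ω : Ultrafilter ℕ}
  [Group G] [Fintype G]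

/-- The generalized tracial Rokhlin property of a separable algebra gives an equivariant orthogonal
partition in `A_ω ∩ A'` with remainder Cuntz below `x`. -/
theorem exists_ultrapower_of_rokhlin (hω : (ω : Filter ℕ) ≤ Filter.cofinite)
    [TopologicalSpace.SeparableSpace A] (α : G →* (A ≃⋆ₐ[ℂ] A))
    (hα : HasGeneralizedTracialRokhlinProperty α) {x : Ultrapower A ω} (hx : 0 ≤ x)
    (hx0 : x ≠ 0) :
    ∃ f : G → Ultrapower A ω, (∀ h, 0 ≤ f h) ∧ (∀ h, ‖f h‖ = 1) ∧
      (∀ h k, h ≠ k → f h * f k = 0) ∧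
      (∀ g h, Ultrapower.action ω α g (f h) = f (g * h)) ∧
      (∀ h, f h ∈ Ultrapower.central A ω) ∧ CuntzSubequiv (1 - ∑ h, f h) x := by
  obtain ⟨y, hy, rfl⟩ := Ultrapower.exists_lift_nonneg hx
  -- Half the norm of `x`: for `ω`-almost all `n` this gives `k < ‖y n‖`, so that `(y n - k)₊` is
  -- nonzero.
  set k := ‖Ultrapower.mk A ω y‖ / 2 with hk
  have hx1 : 0 < ‖Ultrapower.mk A ω y‖ := norm_pos_iff.mpr hx0
  have hk0 : 0 < k := by positivity
  have hyk : ∀ᶠ n in (ω : Filter ℕ), k < ‖y n‖ :=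
    (tendsto_order.mp (Ultrapower.tendsto_norm y)).1 k (by linarith)
  obtain ⟨m, hm⟩ := hyk.exists
  have _ : Nontrivial A := ⟨y m, 0, norm_pos_iff.mp (hk0.trans hm)⟩
  -- Here freeness of `ω` enters: the tolerances tend to `0` along `ω`.
  have hlim : Tendsto (fun n : ℕ => 1 / ((n : ℝ) + 1)) ω (𝓝 0) :=
    tendsto_one_div_add_atTop_nhds_zero_nat.mono_left (Nat.cofinite_eq_atTop ▸ hω)
  have hex : ∀ n : ℕ, ∃ z : A, 0 ≤ z ∧ z ≠ 0 ∧ (k < ‖y n‖ → z = y n - k • clip k (y n)) := by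
    intro n
    by_cases hn : k < ‖y n‖
    · exact ⟨_, sub_clip_nonneg hk0 (hy n), sub_clip_ne_zero hk0 (hy n) hn, fun _ => rfl⟩
    · exact ⟨1, zero_le_one, one_ne_zero, fun h => absurd h hn⟩
  choose z hz hz0 hzy using hex
  classical
  choose e he horth heq hcomm hcuntz using fun n : ℕ =>
    hα ((Finset.range (n + 1)).image (TopologicalSpace.denseSeq A)) (1 / ((n : ℝ) + 1)) (z n)
      (by positivity) (hz n) (hz0 n)
  set N : ℝ := (Fintype.card G : ℝ) with hN
  have hrem : ∀ n, ‖1 - ∑ h, e n h‖ ≤ 1 + N := fun n => by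
    refine (norm_sub_le _ _).trans (add_le_add norm_one.le ?_)
    refine (norm_sum_le_of_le _ fun h _ => (he n h).2.le).trans_eq ?_
    simp [hN]
  -- The bound is uniform in `n`, since the remainder has norm at most `1 + N` and the tolerance is
  -- at most `1`; this lets `s` define an element of `A_ω`.
  have hsex : ∀ n, ∃ s : A, ‖s‖ ≤ √((N + 2) / k) ∧
      (k < ‖y n‖ → ‖s * y n * star s - (1 - ∑ h, e n h)‖ ≤ 1 / ((n : ℝ) + 1)) := by
    intro n
    by_cases hn : k < ‖y n‖
    · have h1 := hcuntz n
      rw [hzy n hn] at h1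
      obtain ⟨s, hs1, hs2⟩ := exists_norm_le_of_cuntzSubequiv_sub_clip (ε := 1 / ((n : ℝ) + 1))
        hk0 (by positivity) (hy n) h1
      refine ⟨s, Real.le_sqrt_of_sq_le ?_, fun _ => hs1.le⟩
      have h2 : 1 / ((n : ℝ) + 1) ≤ 1 := by
        rw [div_le_one (by positivity)]
        linarith [Nat.cast_nonneg (α := ℝ) n]
      rw [le_div_iff₀ hk0]
      linarith [hrem n]
    · exact ⟨0, by simp, fun h => absurd h hn⟩
  choose s hs hsy using hsex
  let E : G → ℕ →ᵇ A := fun h => BoundedContinuousFunction.ofNormedAddCommGroup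
    (fun n => e n h) continuous_of_discreteTopology 1 fun n => (he n h).2.le
  let S : ℕ →ᵇ A := BoundedContinuousFunction.ofNormedAddCommGroup
    s continuous_of_discreteTopology _ hs
  refine ⟨fun h => Ultrapower.mk A ω (E h), fun h => Ultrapower.mk_nonneg fun n => (he n h).1,
    fun h => Ultrapower.norm_mk_eq_of_tendsto (tendsto_const_nhds.congr fun n => (he n h).2.symm),
    fun h k hhk => ?_, fun g h => ?_, fun h => ?_, ?_⟩
  · have h0 : E h * E k = 0 := by
      ext n
      exact horth n h k hhk
    rw [← map_mul, h0, map_zero]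
  · rw [Ultrapower.action_mk, Ultrapower.mk_eq_mk, mem_cOmega]
    exact squeeze_zero (fun _ => norm_nonneg _) (fun n => heq n g h) hlim
  · rw [Ultrapower.mem_central]
    have hcont : Continuous (Ultrapower.const A ω) :=
      AddMonoidHomClass.continuous_of_bound _ 1 fun a => by
        rw [Ultrapower.norm_const, one_mul]
    intro a
    -- Commuting with `f h` is a closed condition, so the dense sequence suffices; its `m`-th term
    -- belongs to the finite set used at stage `n` once `n ≥ m`.
    refine (TopologicalSpace.denseRange_denseSeq A).induction_on a
      (isClosed_eq (hcont.mul continuous_const) (continuous_const.mul hcont)) fun m => Eq.symm ?_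
    rw [Ultrapower.const_apply, ← map_mul, ← map_mul, Ultrapower.mk_eq_mk, mem_cOmega]
    refine squeeze_zero' (.of_forall fun _ => norm_nonneg _) ?_ hlim
    have hm : ∀ᶠ n in (ω : Filter ℕ), m ≤ n :=
      (Nat.cofinite_eq_atTop ▸ hω : (ω : Filter ℕ) ≤ atTop) (eventually_ge_atTop m)
    filter_upwards [hm] with n hn
    exact hcomm n h _ (Finset.mem_image_of_mem _ (Finset.mem_range.mpr (by omega)))
  · have h1 : Ultrapower.mk A ω S * Ultrapower.mk A ω y * star (Ultrapower.mk A ω S)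
        = 1 - ∑ h, Ultrapower.mk A ω (E h) := by
      rw [Ultrapower.star_mk, ← map_mul, ← map_mul, ← map_sum, ← map_one (Ultrapower.mk A ω),
        ← map_sub, Ultrapower.mk_eq_mk, mem_cOmega]
      refine squeeze_zero' (.of_forall fun _ => norm_nonneg _) ?_ hlim
      filter_upwards [hyk] with n hn
      have h2 : (S * y * star S - (1 - ∑ h, E h)) n
          = s n * y n * star (s n) - (1 - ∑ h, e n h) := by
        simp [S, E]
      rw [h2]
      exact hsy n hn
    exact h1 ▸ cuntzSubequiv_conj (Ultrapower.mk A ω S) (Ultrapower.mk A ω y)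

variable [TopologicalSpace G] [DiscreteTopology G]

theorem split_of_hasGeneralizedTracialRokhlinProperty (hω : (ω : Filter ℕ) ≤ Filter.cofinite)
    [TopologicalSpace.SeparableSpace A] (α : G →* (A ≃⋆ₐ[ℂ] A))
    (hα : HasGeneralizedTracialRokhlinProperty α) :
    (equivariantOneTensor α).IsTraciallySequentiallySplitByOrderZero ω := by
  intro x hx hx0
  obtain ⟨f, hf, hf1, horth, heq, hcen, hcuntz⟩ := exists_ultrapower_of_rokhlin hω α hα hx hx0
  have hcomm : ∀ h a, Commute (Ultrapower.const A ω a) (f h) := fun h a =>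
    Ultrapower.mem_central.mp (hcen h) a
  have hsum : ∀ a : A, weightedEval (Ultrapower.const A ω) f hf hcomm (oneTensor G a)
      = Ultrapower.const A ω a * ∑ h, f h := fun a => by
    rw [weightedEval_apply, Finset.mul_sum]
    refine Finset.sum_congr rfl fun h _ => ?_
    change Ultrapower.const A ω ((1 : ℂ) • a) * f h = _
    rw [one_smul]
  have hgcen : ∑ h, f h ∈ Ultrapower.central A ω := sum_mem fun h _ => hcen h
  refine ⟨weightedEval (Ultrapower.const A ω) f hf hcomm, fun a b _ _ hab hba =>
    ⟨weightedEval_mul_eq_zero _ hf hcomm horth hab, weightedEval_mul_eq_zero _ hf hcomm horth hba⟩,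
    fun k F => ?_, ∑ h, f h, hgcen, Finset.sum_nonneg fun h _ => hf h, fun h0 => ?_,
    fun a => ⟨(hsum a).trans (Ultrapower.mem_central.mp hgcen a), hsum a⟩, hcuntz⟩
  · rw [weightedEval_apply, weightedEval_apply, map_sum]
    -- Equivariance is the reindexing `h ↦ k * h`, since `α_ω` sends `f h` to `f (k * h)`.
    refine (Fintype.sum_equiv (Equiv.mulLeft k) _ _ fun h => ?_).symm
    rw [map_mul, heq]
    congr 1
    change Ultrapower.const A ω (α k (F h)) = Ultrapower.const A ω (α k (F (k⁻¹ * (k * h))))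
    rw [inv_mul_cancel_left]
  · have h1 : f 1 ≤ 0 := h0 ▸ Finset.single_le_sum (fun h _ => hf h) (Finset.mem_univ 1)
    have h2 := hf1 1
    rw [le_antisymm h1 (hf 1), norm_zero] at h2
    exact zero_ne_one h2

end Forward

theorem corollaryC (ω : Ultrafilter ℕ) (hω : (ω : Filter ℕ) ≤ Filter.cofinite)
    {G : Type*} [Group G] [Fintype G] [TopologicalSpace G] [DiscreteTopology G]
    {A : Type*} [CStarAlgebra A] [PartialOrder A] [StarOrderedRing A]
    (hsimple : IsSimpleCStarAlgebra A)
    (hsep : TopologicalSpace.SeparableSpace A)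
    (hinf : ¬ FiniteDimensional ℂ A)
    (α : G →* (A ≃⋆ₐ[ℂ] A)) :
    HasGeneralizedTracialRokhlinProperty α ↔
      (equivariantOneTensor α).IsTraciallySequentiallySplitByOrderZero ω :=
  ⟨split_of_hasGeneralizedTracialRokhlinProperty hω α,
    hasGeneralizedTracialRokhlinProperty_of_split α⟩
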